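/- Let $n\ge 1$ and $k\ge 2$ be integers and let $$\Gamma_{n,k}=\langle a,b_1,\dots,b_n \mid ab_ia^{-1}=b_i^k,\ b_ib_j=b_jb_i \text{ for all } i,j=1,\dots,n\rangle .$$ Let $\mathcal D(\mathbb R^n,0)$ be the group (under composition) of germs at $0$ of $C^\infty$ local diffeomorphisms of $\mathbb R^n$ fixing the origin. For $F\in\mathcal D(\mathbb R^n,0)$ let $D^{(i)}_0F$ be its $i$-th derivative at $0$, a symmetric $i$-multilinear map $(\mathbb R^n)^i\to\mathbb R^n$, and for such a map $T$ put $\|T\|^{(i)}=\sup\{\|T(\xi_1,\dots,\xi_i)\| : \|\xi_j\|\le 1 \text{ for all } j\}$, where $\|\cdot\|$ is the Euclidean norm. The $C^2_{loc}$-topology on $\mathcal D(\mathbb R^n,0)$ is the topology of the pseudo-distance $$d(F,G)=\|D^{(1)}_0F-D^{(1)}_0G\|^{(1)}+\|D^{(2)}_0F-D^{(2)}_0G\|^{(2)},$$ and the $C^2_{loc}$-topology on the set $\mathrm{Hom}(\Gamma_{n,k},\mathcal D(\mathbb R^n,0))$ of local actions is the one induced by the product topology on $\mathcal D(\mathbb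 R^n,0)^{\Gamma_{n,k}}$. Write $P^\gamma=P(\gamma)$. Two local actions $P_1,P_2$ are smoothly conjugate if there is $H\in\mathcal D(\mathbb R^n,0)$ with $P_2^\gamma\circ H=H\circ P_1^\gamma$ for all $\gamma\in\Gamma_{n,k}$. For $B\in \mathrm{GL}_n(\mathbb R)$ with columns $v_1,\dots,v_n$, let $\rho_B$ be the action of $\Gamma_{n,k}$ on $S^n=\mathbb R^n\cup\{\infty\}$ that fixes $\infty$ and satisfies $\rho_B^a(x)=kx$ and $\rho_B^{b_i}(x)=x+v_i$ for $x\in\mathbb R^n$. Let $\bar\phi:S^n\setminus\{0\}\to\mathbb R^n$ be given by $\bar\phi(x)=x/\|x\|^2$ for $x \neq \infty$ and $\bar\phi(\infty)=0$, and let $P_B\in\mathrm{Hom}(\Gamma_{n,k},\mathcal D(\mathbb R^n,0))$ be the local action for which $P_B^\gamma$ is the germ at $0$ of $\bar\phi\circ\rho_B^\gamma\circ\bar\phi^{-1}$. Theorem. For every $B\in\mathrm{GL}_n(\mathbb R)$ there exists a $C^2_{loc}$-neighbourhood $\mathcal U$ of $P_B$ in $\mathrm{Hom}(\Gamma_{n,k},\mathcal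 D(\mathbb R^n,0))$ such that every local action $P\in\mathcal U$ is smoothly conjugate to $P_{B'}$ for some $B'=B'(P)\in\mathrm{GL}_n(\mathbb R)$. -/

import Mathlib

open Filter Topology
open scoped ContDiff

noncomputable section

/-! ### The group of germs at the origin of local diffeomorphisms -/

section Germs

variable (E : Type*) [NormedAddCommGroup E] [NormedSpace ℝ E]

/-- A local (smooth, i.e. `C^∞`) diffeomorphism of `E` at the origin, fixing the origin: a map which
is smooth on a neighbourhood of `0`, together with a map smooth on a neighbourhood of `0` that is
inverse to it near `0`. Only the behaviour near `0` matters, see `DiffGerm`. -/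
structure LocalDiffeo where
  /-- the map -/
  toFun : E → E
  /-- a local inverse -/
  invFun : E → E
  map_zero : toFun 0 = 0
  smooth_toFun : ∀ᶠ x in 𝓝 (0 : E), ContDiffAt ℝ ∞ toFun x
  smooth_invFun : ∀ᶠ x in 𝓝 (0 : E), ContDiffAt ℝ ∞ invFun x
  left_inv : ∀ᶠ x in 𝓝 (0 : E), invFun (toFun x) = x
  right_inv : ∀ᶠ x in 𝓝 (0 : E), toFun (invFun x) = x

namespace LocalDiffeo

variable {E}

theorem inv_map_zero (f : LocalDiffeo E) : f.invFun 0 = 0 := by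
  have h := f.left_inv.self_of_nhds
  rwa [f.map_zero] at h

theorem tendsto (f : LocalDiffeo E) : Tendsto f.toFun (𝓝 0) (𝓝 0) := by
  have h := f.smooth_toFun.self_of_nhds.continuousAt.tendsto
  rwa [f.map_zero] at h

theorem tendsto_inv (f : LocalDiffeo E) : Tendsto f.invFun (𝓝 0) (𝓝 0) := by
  have h := f.smooth_invFun.self_of_nhds.continuousAt.tendsto
  rwa [f.inv_map_zero] at h

/-- The identity. -/
def id : LocalDiffeo E where
  toFun := fun x => x
  invFun := fun x => x
  map_zero := rfl
  smooth_toFun := Eventually.of_forall fun _ => contDiffAt_id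
  smooth_invFun := Eventually.of_forall fun _ => contDiffAt_id
  left_inv := Eventually.of_forall fun _ => rfl
  right_inv := Eventually.of_forall fun _ => rfl

/-- The composition `f ∘ g`. -/
def comp (f g : LocalDiffeo E) : LocalDiffeo E where
  toFun := fun x => f.toFun (g.toFun x)
  invFun := fun x => g.invFun (f.invFun x)
  map_zero := by rw [g.map_zero, f.map_zero]
  smooth_toFun := by
    filter_upwards [g.tendsto.eventually f.smooth_toFun, g.smooth_toFun] with x hf hg
    exact hf.comp x hg
  smooth_invFun := by
    filter_upwards [f.tendsto_inv.eventually g.smooth_invFun, f.smooth_invFun] with x hg hf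
    exact hg.comp x hf
  left_inv := by
    filter_upwards [g.tendsto.eventually f.left_inv, g.left_inv] with x hf hg
    rw [hf, hg]
  right_inv := by
    filter_upwards [f.tendsto_inv.eventually g.right_inv, f.right_inv] with x hg hf
    rw [hg, hf]

/-- The local inverse. -/
def symm (f : LocalDiffeo E) : LocalDiffeo E where
  toFun := f.invFun
  invFun := f.toFun
  map_zero := f.inv_map_zero
  smooth_toFun := f.smooth_invFun
  smooth_invFun := f.smooth_toFun
  left_inv := f.right_inv
  right_inv := f.left_inv

/-- Two local diffeomorphisms define the same germ if they agree on a neighbourhood of `0`. -/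
instance germSetoid : Setoid (LocalDiffeo E) where
  r f g := f.toFun =ᶠ[𝓝 0] g.toFun
  iseqv := ⟨fun _ => EventuallyEq.rfl, fun h => h.symm, fun h h' => h.trans h'⟩

theorem equiv_iff (f g : LocalDiffeo E) : f ≈ g ↔ f.toFun =ᶠ[𝓝 0] g.toFun := Iff.rfl

theorem comp_congr {f f' g g' : LocalDiffeo E} (hf : f ≈ f') (hg : g ≈ g') :
    f.comp g ≈ f'.comp g' := by
  rw [equiv_iff] at *
  filter_upwards [g.tendsto.eventually hf, hg] with x h1 h2
  change f.toFun (g.toFun x) = f'.toFun (g'.toFun x)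
  rw [h1, h2]

theorem symm_congr {f g : LocalDiffeo E} (h : f ≈ g) : f.symm ≈ g.symm := by
  rw [equiv_iff] at *
  filter_upwards [f.right_inv, f.tendsto_inv.eventually h, f.tendsto_inv.eventually g.left_inv]
    with x h1 h2 h3
  change f.invFun x = g.invFun x
  rw [← h2, h1] at h3
  exact h3.symm

end LocalDiffeo

/-- The group `𝒟(E, 0)` of germs at `0` of local diffeomorphisms of `E` fixing the origin. -/
def DiffGerm : Type _ := Quotient (LocalDiffeo.germSetoid (E := E))

variable {E}

/-- The germ at `0` of a local diffeomorphism. -/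
def LocalDiffeo.germ (f : LocalDiffeo E) : DiffGerm E := Quotient.mk _ f

namespace DiffGerm

/-- The group structure is composition of germs: `F * G` is `F ∘ G`. -/
instance : Group (DiffGerm E) where
  mul := Quotient.map₂ LocalDiffeo.comp fun _ _ hf _ _ hg => LocalDiffeo.comp_congr hf hg
  one := LocalDiffeo.id.germ
  inv := Quotient.map LocalDiffeo.symm fun _ _ h => LocalDiffeo.symm_congr h
  mul_assoc := by
    rintro ⟨f⟩ ⟨g⟩ ⟨h⟩
    rfl
  one_mul := by
    rintro ⟨f⟩
    rfl
  mul_one := by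
    rintro ⟨f⟩
    rfl
  inv_mul_cancel := by
    rintro ⟨f⟩
    exact Quotient.sound f.left_inv

/-- The `r`-th derivative of a germ at the origin, as an `r`-linear map; its norm is the
operator norm `sup {‖F(ξ₁, …, ξᵣ)‖ : ‖ξᵢ‖ ≤ 1}`. -/
def derivAtZero (r : ℕ) (F : DiffGerm E) : E [×r]→L[ℝ] E :=
  Quotient.lift (fun f : LocalDiffeo E => iteratedFDeriv ℝ r f.toFun 0)
    (fun _ _ h => (EventuallyEq.iteratedFDeriv ℝ h r).self_of_nhds) F

/-- The pseudo-distance `∑_{i = 1}^r ‖D^i_0 F - D^i_0 G‖`. -/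
def locDist (r : ℕ) (F G : DiffGerm E) : ℝ :=
  ∑ i ∈ Finset.Icc 1 r, ‖derivAtZero i F - derivAtZero i G‖

/-- The pseudo-metric structure on germs given by `locDist r`. -/
@[reducible] def locPseudoMetric (E : Type*) [NormedAddCommGroup E] [NormedSpace ℝ E] (r : ℕ) :
    PseudoMetricSpace (DiffGerm E) where
  dist := locDist r
  dist_self F := by simp [locDist]
  dist_comm F G := by simp only [locDist, norm_sub_rev]
  dist_triangle F G H := by
    simp only [locDist, ← Finset.sum_add_distrib]
    exact Finset.sum_le_sum fun i _ => norm_sub_le_norm_sub_add_norm_sub _ _ _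

/-- The `C^r_loc`-topology on the group of germs. -/
@[reducible] def locTopology (E : Type*) [NormedAddCommGroup E] [NormedSpace ℝ E] (r : ℕ) :
    TopologicalSpace (DiffGerm E) :=
  (locPseudoMetric E r).toUniformSpace.toTopologicalSpace

end DiffGerm

/-- The `C^r_loc`-topology on the set `Hom(Γ, 𝒟(E, 0))` of local actions of `Γ`: the topology
induced by the product topology on `𝒟(E, 0)^Γ`, where `𝒟(E, 0)` has the `C^r_loc`-topology. -/
@[reducible] def locActionTopology (Γ : Type*) [Group Γ] (E : Type*) [NormedAddCommGroup E]
    [NormedSpace ℝ E] (r : ℕ) : TopologicalSpace (Γ →* DiffGerm E) :=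
  TopologicalSpace.induced (fun P γ => P γ)
    (@Pi.topologicalSpace Γ (fun _ => DiffGerm E) fun _ => DiffGerm.locTopology E r)

/-- Two local actions are smoothly conjugate if `P₂^γ ∘ H = H ∘ P₁^γ` for all `γ`, for some germ of
a local diffeomorphism `H`. -/
def SmoothlyConjugate {Γ : Type*} [Group Γ] (P₁ P₂ : Γ →* DiffGerm E) : Prop :=
  ∃ H : DiffGerm E, ∀ γ : Γ, P₂ γ * H = H * P₁ γ

end Germs

/-! ### The group `Γ_{n,k}` -/

/-- The generators `a, b₁, …, bₙ`. -/
inductive BSGen (n : ℕ) : Type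
  | a : BSGen n
  | b (i : Fin n) : BSGen n

/-- The relators `a bᵢ a⁻¹ (bᵢ^k)⁻¹` and `bᵢ bⱼ (bⱼ bᵢ)⁻¹`. -/
def bsRels (n k : ℕ) : Set (FreeGroup (BSGen n)) :=
  {w | ∃ i : Fin n, w = FreeGroup.of .a * FreeGroup.of (.b i) * (FreeGroup.of .a)⁻¹ *
      (FreeGroup.of (.b i) ^ k)⁻¹} ∪
  {w | ∃ i j : Fin n, w = FreeGroup.of (.b i) * FreeGroup.of (.b j) *
      (FreeGroup.of (.b j) * FreeGroup.of (.b i))⁻¹}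

/-- The group `Γ_{n,k} = ⟨a, b₁, …, bₙ | a bᵢ a⁻¹ = bᵢ^k, bᵢ bⱼ = bⱼ bᵢ⟩`. -/
abbrev BSGroup (n k : ℕ) : Type := PresentedGroup (bsRels n k)

/-! ### The standard action on the sphere and its local action at infinity -/

/-- `ℝⁿ` with its Euclidean norm; the sphere `Sⁿ = ℝⁿ ∪ {∞}` is `OnePoint (Eucl n)`. -/
abbrev Eucl (n : ℕ) : Type := EuclideanSpace ℝ (Fin n)

section StandardAction

variable {n k : ℕ}

/-- A bijection of `ℝⁿ`, extended to `Sⁿ = ℝⁿ ∪ {∞}` by `∞ ↦ ∞`. -/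
def extendInfty (e : Equiv.Perm (Eucl n)) : Equiv.Perm (OnePoint (Eucl n)) where
  toFun := OnePoint.map e
  invFun := OnePoint.map e.symm
  left_inv x := by cases x <;> simp
  right_inv x := by cases x <;> simp

theorem extendInfty_coe (e : Equiv.Perm (Eucl n)) (x : Eucl n) :
    extendInfty e (x : OnePoint (Eucl n)) = ((e x : Eucl n) : OnePoint (Eucl n)) := rfl

theorem extendInfty_infty (e : Equiv.Perm (Eucl n)) :
    extendInfty e OnePoint.infty = OnePoint.infty := rfl

theorem extendInfty_mul (e f : Equiv.Perm (Eucl n)) :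
    extendInfty (e * f) = extendInfty e * extendInfty f := by
  ext x
  cases x <;> rfl

/-- The dilation `x ↦ kx`. -/
def dilation (n : ℕ) (hk : 2 ≤ k) : Equiv.Perm (Eucl n) where
  toFun x := (k : ℝ) • x
  invFun x := (k : ℝ)⁻¹ • x
  left_inv x := inv_smul_smul₀ (by positivity) x
  right_inv x := smul_inv_smul₀ (by positivity) x

/-- The translation `x ↦ x + v`. -/
def translation (v : Eucl n) : Equiv.Perm (Eucl n) := Equiv.addRight v

/-- The `i`-th column `vᵢ` of `B`. -/
def column (B : Matrix (Fin n) (Fin n) ℝ) (i : Fin n) : Eucl n := WithLp.toLp 2 fun j => B j i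

/-- The transformations by which the generators act: `a` by `x ↦ kx` and `bᵢ` by `x ↦ x + vᵢ`. -/
def standardGen (hk : 2 ≤ k) (B : Matrix (Fin n) (Fin n) ℝ) :
    BSGen n → Equiv.Perm (OnePoint (Eucl n))
  | .a => extendInfty (dilation n hk)
  | .b i => extendInfty (translation (column B i))

theorem translation_pow (v : Eucl n) (m : ℕ) : translation v ^ m = translation ((m : ℝ) • v) := by
  induction m with
  | zero => ext x : 1; simp [translation]
  | succ m ih =>
    ext x : 1
    rw [pow_succ, ih]
    simp only [translation, Equiv.Perm.mul_apply, Equiv.coe_addRight]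
    push_cast
    module

theorem extendInfty_pow (e : Equiv.Perm (Eucl n)) (m : ℕ) :
    extendInfty (e ^ m) = extendInfty e ^ m := by
  induction m with
  | zero => ext x; cases x <;> rfl
  | succ m ih => rw [pow_succ, pow_succ, extendInfty_mul, ih]

theorem standardGen_rels (hk : 2 ≤ k) (B : Matrix (Fin n) (Fin n) ℝ) :
    ∀ w ∈ bsRels n k, FreeGroup.lift (standardGen hk B) w = 1 := by
  rintro w (⟨i, rfl⟩ | ⟨i, j, rfl⟩)
  · simp only [map_mul, map_inv, map_pow, FreeGroup.lift_apply_of, standardGen]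
    rw [mul_inv_eq_one, mul_inv_eq_iff_eq_mul, ← extendInfty_pow, ← extendInfty_mul,
      ← extendInfty_mul, translation_pow]
    congr 1
    ext x : 1
    simp [translation, dilation]
  · simp only [map_mul, map_inv, FreeGroup.lift_apply_of, standardGen]
    rw [mul_inv_eq_one, ← extendInfty_mul, ← extendInfty_mul]
    congr 1
    ext x : 1
    simp only [translation, Equiv.Perm.mul_apply, Equiv.coe_addRight]
    abel

/-- The standard action `ρ_B` of `Γ_{n,k}` on `Sⁿ = ℝⁿ ∪ {∞}`: `ρ_B^a(x) = kx`,
`ρ_B^{bᵢ}(x) = x + vᵢ`, where `B = (v₁, …, vₙ)`, and `∞` is fixed. -/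
def standardAction (hk : 2 ≤ k) (B : Matrix (Fin n) (Fin n) ℝ) :
    BSGroup n k →* Equiv.Perm (OnePoint (Eucl n)) :=
  PresentedGroup.toGroup (standardGen_rels hk B)

/-- The coordinate `φ̄(x) = x / ‖x‖²` of `Sⁿ \ {0}`, with `φ̄(∞) = 0` (the value at the
point `0 ∈ Sⁿ`, which is not in the domain of `φ̄`, plays no role). -/
def inversionChart : OnePoint (Eucl n) → Eucl n
  | OnePoint.infty => 0
  | OnePoint.some x => (‖x‖ ^ 2)⁻¹ • x

open Classical in
/-- The inverse `φ̄⁻¹ : ℝⁿ → Sⁿ \ {0}`. -/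
def inversionChartInv (y : Eucl n) : OnePoint (Eucl n) :=
  if y = 0 then OnePoint.infty else (((‖y‖ ^ 2)⁻¹ • y : Eucl n) : OnePoint (Eucl n))

theorem inversionChart_infty : inversionChart (OnePoint.infty : OnePoint (Eucl n)) = 0 := rfl

theorem inversionChart_coe (x : Eucl n) :
    inversionChart (x : OnePoint (Eucl n)) = (‖x‖ ^ 2)⁻¹ • x := rfl

theorem inversionChart_inversionChartInv (y : Eucl n) :
    inversionChart (inversionChartInv y) = y := by
  unfold inversionChartInv
  split_ifs with h
  · rw [h, inversionChart_infty]
  · rw [inversionChart_coe, norm_smul, smul_smul]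
    have h' : ‖y‖ ≠ 0 := norm_ne_zero_iff.mpr h
    rw [norm_inv, norm_pow, norm_norm]
    convert one_smul ℝ y using 2
    field_simp

theorem inversionChartInv_inversionChart (x : OnePoint (Eucl n))
    (hx : x ≠ ((0 : Eucl n) : OnePoint (Eucl n))) : inversionChartInv (inversionChart x) = x := by
  cases x with
  | infty => rw [inversionChart_infty]; simp [inversionChartInv]
  | coe x =>
    have h : x ≠ 0 := fun h => hx (by rw [h])
    have h' : ‖x‖ ≠ 0 := norm_ne_zero_iff.mpr h
    rw [inversionChart_coe, inversionChartInv, if_neg (by simp [h]), norm_smul, smul_smul,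
      norm_inv, norm_pow, norm_norm]
    congr 1
    convert one_smul ℝ x using 2
    field_simp

/-- Every element of `Γ_{n,k}` acts by `x ↦ s x + v` for some `s ≠ 0` and some vector `v`. -/
theorem standardAction_form (hk : 2 ≤ k) (B : Matrix (Fin n) (Fin n) ℝ) (γ : BSGroup n k) :
    standardAction hk B γ OnePoint.infty = OnePoint.infty ∧
    ∃ (s : ℝ) (v : Eucl n), s ≠ 0 ∧ ∀ x : Eucl n,
      standardAction hk B γ (x : OnePoint (Eucl n)) =
        ((s • x + v : Eucl n) : OnePoint (Eucl n)) := by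
  have hγ : γ ∈ Subgroup.closure (Set.range (PresentedGroup.of (rels := bsRels n k))) := by
    rw [PresentedGroup.closure_range_of]
    trivial
  induction hγ using Subgroup.closure_induction with
  | mem γ h =>
    obtain ⟨g, rfl⟩ := h
    rw [standardAction, PresentedGroup.toGroup.of]
    cases g with
    | a =>
      refine ⟨rfl, (k : ℝ), 0, by positivity, fun x => ?_⟩
      rw [add_zero]
      rfl
    | b i =>
      refine ⟨rfl, 1, column B i, one_ne_zero, fun x => ?_⟩
      rw [one_smul]
      rfl
  | one => exact ⟨by simp, 1, 0, one_ne_zero, fun x => by simp⟩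
  | mul γ δ _ _ h1 h2 =>
    obtain ⟨hi, s, v, hs, h⟩ := h1
    obtain ⟨hi', s', v', hs', h'⟩ := h2
    refine ⟨by rw [map_mul, Equiv.Perm.mul_apply, hi', hi], s * s', s • v' + v,
      mul_ne_zero hs hs', fun x => ?_⟩
    rw [map_mul, Equiv.Perm.mul_apply, h', h]
    congr 1
    module
  | inv γ _ h1 =>
    obtain ⟨hi, s, v, hs, h⟩ := h1
    refine ⟨by rw [map_inv, Equiv.Perm.inv_eq_iff_eq, hi], s⁻¹, -(s⁻¹ • v), inv_ne_zero hs,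
      fun x => ?_⟩
    rw [map_inv, Equiv.Perm.inv_eq_iff_eq, h]
    congr 1
    rw [smul_add, smul_neg, smul_inv_smul₀ hs, smul_inv_smul₀ hs, neg_add_cancel_right]

/-- The map `φ̄ ∘ ρ_B^γ ∘ φ̄⁻¹`. -/
def localMap (hk : 2 ≤ k) (B : Matrix (Fin n) (Fin n) ℝ) (γ : BSGroup n k) (y : Eucl n) :
    Eucl n :=
  inversionChart (standardAction hk B γ (inversionChartInv y))

theorem localMap_zero (hk : 2 ≤ k) (B : Matrix (Fin n) (Fin n) ℝ) (γ : BSGroup n k) :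
    localMap hk B γ 0 = 0 := by
  rw [localMap, inversionChartInv, if_pos rfl, (standardAction_form hk B γ).1,
    inversionChart_infty]

/-- An explicit formula: if `ρ_B^γ(x) = s x + v`, then
`φ̄ ∘ ρ_B^γ ∘ φ̄⁻¹ (y) = (s y + ‖y‖² v) / (s² + 2 s ⟨y, v⟩ + ‖y‖² ‖v‖²)`. -/
theorem localMap_formula (hk : 2 ≤ k) (B : Matrix (Fin n) (Fin n) ℝ) (γ : BSGroup n k) :
    ∃ (s : ℝ) (v : Eucl n), s ≠ 0 ∧ ∀ y : Eucl n, localMap hk B γ y =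
      (s ^ 2 + 2 * s * inner ℝ y v + ‖y‖ ^ 2 * ‖v‖ ^ 2)⁻¹ • (s • y + ‖y‖ ^ 2 • v) := by
  obtain ⟨-, s, v, hs, h⟩ := standardAction_form hk B γ
  refine ⟨s, v, hs, fun y => ?_⟩
  by_cases hy : y = 0
  · subst hy
    rw [localMap_zero]
    simp
  · have h' : ‖y‖ ≠ 0 := norm_ne_zero_iff.mpr hy
    rw [localMap, inversionChartInv, if_neg hy, h, inversionChart_coe]
    have h1 : s • (‖y‖ ^ 2)⁻¹ • y + v = (‖y‖ ^ 2)⁻¹ • (s • y + ‖y‖ ^ 2 • v) := by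
      rw [smul_add, smul_smul (‖y‖ ^ 2)⁻¹ (‖y‖ ^ 2), inv_mul_cancel₀ (by positivity), one_smul,
        smul_comm]
    have h2 : ‖s • y + ‖y‖ ^ 2 • v‖ ^ 2 =
        ‖y‖ ^ 2 * (s ^ 2 + 2 * s * inner ℝ y v + ‖y‖ ^ 2 * ‖v‖ ^ 2) := by
      rw [norm_add_sq_real, norm_smul, norm_smul, real_inner_smul_left, real_inner_smul_right,
        mul_pow, mul_pow, Real.norm_eq_abs, sq_abs, norm_pow, norm_norm]
      ring
    rw [h1, norm_smul, mul_pow, h2, smul_smul, norm_inv, norm_pow, norm_norm]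
    congr 1
    rw [mul_inv, mul_inv, ← inv_pow, ← inv_pow]
    field_simp

theorem localMap_smooth (hk : 2 ≤ k) (B : Matrix (Fin n) (Fin n) ℝ) (γ : BSGroup n k) :
    ∀ᶠ y in 𝓝 (0 : Eucl n), ContDiffAt ℝ ∞ (localMap hk B γ) y := by
  obtain ⟨s, v, hs, h⟩ := localMap_formula hk B γ
  rw [show localMap hk B γ = _ from funext h]
  have hc : ContDiff ℝ ∞
      fun y : Eucl n => s ^ 2 + 2 * s * inner ℝ y v + ‖y‖ ^ 2 * ‖v‖ ^ 2 := by
    have hn := contDiff_norm_sq ℝ (E := Eucl n) (n := ∞)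
    have hi : ContDiff ℝ ∞ fun y : Eucl n => inner ℝ y v := contDiff_id.inner ℝ contDiff_const
    exact (contDiff_const.add (contDiff_const.mul hi)).add (hn.mul contDiff_const)
  have hne : ∀ᶠ y in 𝓝 (0 : Eucl n),
      s ^ 2 + 2 * s * inner ℝ y v + ‖y‖ ^ 2 * ‖v‖ ^ 2 ≠ 0 := by
    refine hc.continuous.continuousAt.eventually_ne ?_
    simp [hs]
  filter_upwards [hne] with y hy
  have hn := contDiff_norm_sq ℝ (E := Eucl n) (n := ∞)
  have h1 : ContDiff ℝ ∞ fun y : Eucl n => s • y + ‖y‖ ^ 2 • v := by fun_prop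
  exact (hc.contDiffAt.inv hy).smul h1.contDiffAt

theorem standardAction_ne_zero (hk : 2 ≤ k) (B : Matrix (Fin n) (Fin n) ℝ) (γ : BSGroup n k) :
    ∀ᶠ y in 𝓝 (0 : Eucl n), standardAction hk B γ (inversionChartInv y) ≠
      ((0 : Eucl n) : OnePoint (Eucl n)) := by
  obtain ⟨hi, s, v, hs, h⟩ := standardAction_form hk B γ
  have hne : ∀ᶠ y in 𝓝 (0 : Eucl n), s • y + ‖y‖ ^ 2 • v = 0 → y = 0 := by
    have hc : ContinuousAt (fun y : Eucl n => |s| - ‖y‖ * ‖v‖) 0 := by fun_prop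
    have : ∀ᶠ y in 𝓝 (0 : Eucl n), 0 < |s| - ‖y‖ * ‖v‖ :=
      hc.eventually (lt_mem_nhds (by simpa using hs))
    filter_upwards [this] with y hy h0
    by_contra hy0
    have h' : 0 < ‖y‖ := norm_pos_iff.mpr hy0
    have h1 : ‖s • y‖ = ‖‖y‖ ^ 2 • v‖ := by
      rw [eq_neg_of_add_eq_zero_left h0, norm_neg]
    rw [norm_smul, norm_smul, Real.norm_eq_abs, norm_pow, norm_norm] at h1
    nlinarith [mul_pos h' hy]
  filter_upwards [hne] with y hy
  unfold inversionChartInv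
  split_ifs with h0
  · rw [hi]
    exact OnePoint.infty_ne_coe _
  · rw [h]
    intro hc
    refine h0 (hy ?_)
    have h1 : s • (‖y‖ ^ 2)⁻¹ • y + v = 0 := OnePoint.coe_injective hc
    have h' : ‖y‖ ≠ 0 := norm_ne_zero_iff.mpr h0
    have h2 := congrArg (fun z => ‖y‖ ^ 2 • z) h1
    simp only [smul_add, smul_zero] at h2
    rwa [smul_comm, smul_inv_smul₀ (by positivity)] at h2

theorem localMap_mul (hk : 2 ≤ k) (B : Matrix (Fin n) (Fin n) ℝ) (γ δ : BSGroup n k) :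
    ∀ᶠ y in 𝓝 (0 : Eucl n), localMap hk B (γ * δ) y = localMap hk B γ (localMap hk B δ y) := by
  filter_upwards [standardAction_ne_zero hk B δ] with y hy
  simp only [localMap]
  rw [inversionChartInv_inversionChart _ hy, map_mul, Equiv.Perm.mul_apply]

theorem localMap_one (hk : 2 ≤ k) (B : Matrix (Fin n) (Fin n) ℝ) (y : Eucl n) :
    localMap hk B 1 y = y := by
  rw [localMap, map_one, Equiv.Perm.one_apply, inversionChart_inversionChartInv]

/-- `φ̄ ∘ ρ_B^γ ∘ φ̄⁻¹` as a local diffeomorphism at the origin. -/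
def localMapDiffeo (hk : 2 ≤ k) (B : Matrix (Fin n) (Fin n) ℝ) (γ : BSGroup n k) :
    LocalDiffeo (Eucl n) where
  toFun := localMap hk B γ
  invFun := localMap hk B γ⁻¹
  map_zero := localMap_zero hk B γ
  smooth_toFun := localMap_smooth hk B γ
  smooth_invFun := localMap_smooth hk B γ⁻¹
  left_inv := by
    filter_upwards [localMap_mul hk B γ⁻¹ γ] with y hy
    rw [← hy, inv_mul_cancel, localMap_one]
  right_inv := by
    filter_upwards [localMap_mul hk B γ γ⁻¹] with y hy
    rw [← hy, mul_inv_cancel, localMap_one]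

/-- The local action `P_B` of `Γ_{n,k}`: `P_B^γ` is the germ at `0` of `φ̄ ∘ ρ_B^γ ∘ φ̄⁻¹`. -/
def standardLocalAction (hk : 2 ≤ k) (B : Matrix (Fin n) (Fin n) ℝ) :
    BSGroup n k →* DiffGerm (Eucl n) where
  toFun γ := (localMapDiffeo hk B γ).germ
  map_one' := Quotient.sound (Eventually.of_forall (localMap_one hk B))
  map_mul' γ δ := Quotient.sound (localMap_mul hk B γ δ)

end StandardAction

end

/-! Write I for `inversionTensor` and vᵢ for the columns of B. At the origin P_B^a is x ↦ x/k, and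
P_B^{bᵢ} is x ↦ x + I(vᵢ)(x, x) + O(‖x‖³). The theorem says that this picture is rigid; the proof
reduces it to the algebra of 2-jets.

Two analytic facts make the reduction. A smooth germ whose differential is r·id with 0 < r < 1 has
no resonances, and the limit of r⁻ᵐFᵐ linearizes it smoothly
(`IsHomotheticContraction.exists_linearization`). Once a is the homothety of ratio 1/k, the relation
a b = bᵏ a reads g(x) = k gᵏ(x/k), and a germ tangent to the identity that solves this equation is
determined by its 2-jet, because third order differences are contracted by a factor close to 1/k
(`eventuallyEq_of_functional_equation`).

The linear parts do not move. If A is near (1/k)·id, C is near 1 and AC = CᵏA, then C = 1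
(`eventually_eq_one_of_mul_eq_pow_mul`). With Dbᵢ = 1 known, the second order part of the same
relation says that Da intertwines the quadratic parts up to the factor k, which forces Da = (1/k)·id
(`eventually_eq_smul_one_of_equivariant`).

The quadratic parts of the bᵢ give commuting quadratic vector fields, hence a linear family Q close
to I. Every such family is L ∘ I(M·)(L⁻¹·, L⁻¹·) for linear automorphisms L and M
(`eventually_exists_equiv`). Infinitesimally this is `LinearizedCommute.eq_variation`: each
symmetric solution of the linearized commutation relation is tangent to the orbit of I under changes
of L and M. A slice transverse to the orbit and a compactness argument pass from the infinitesimal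
statement to a neighbourhood.

In the end the linearizer of a followed by L⁻¹ carries the 2-jets of the action to those of P_{B'},
where B' has columns M vᵢ, and uniqueness gives equality of germs. -/

/-! ### Infinitesimal rigidity of the quadratic parts. -/

section InversionTensor

set_option maxSynthPendingDepth 3

open scoped RealInnerProductSpace

variable {E : Type*} [NormedAddCommGroup E] [InnerProductSpace ℝ E]

/-- Families, linear in a vector of `E`, of bilinear maps `E × E → E`. -/
abbrev TriMap (E : Type*) [NormedAddCommGroup E] [InnerProductSpace ℝ E] : Type _ :=
  E →L[ℝ] E →L[ℝ] E →L[ℝ] E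

/-- The bilinear maps `(x, y) ↦ ⟪x, y⟫ v - ⟪x, v⟫ y - ⟪y, v⟫ x`, whose quadratic forms are the
quadratic parts at the origin of the translations seen through the inversion. -/
noncomputable def inversionTensor (E : Type*) [NormedAddCommGroup E] [InnerProductSpace ℝ E] :
    TriMap E :=
  letI S : TriMap E := ((ContinuousLinearMap.smulRightL ℝ E (E →L[ℝ] E)).flip
    (ContinuousLinearMap.id ℝ E)).comp (innerSL ℝ)
  letI R : TriMap E :=
    ((ContinuousLinearMap.compL ℝ E (E →L[ℝ] ℝ) (E →L[ℝ] E)).flip (innerSL ℝ)).comp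
      (ContinuousLinearMap.smulRightL ℝ E E).flip
  R - S - (ContinuousLinearMap.flipₗᵢ ℝ E E E).toContinuousLinearEquiv.toContinuousLinearMap.comp S

@[simp]
theorem inversionTensor_apply (v x y : E) :
    inversionTensor E v x y = ⟪x, y⟫ • v - ⟪x, v⟫ • y - ⟪y, v⟫ • x := by
  simp [inversionTensor, real_inner_comm]
  rfl

/-- The infinitesimal action of a pair of linear maps on `inversionTensor`. -/
noncomputable def inversionTensorVariation (e f : E →L[ℝ] E) : TriMap E :=
  (ContinuousLinearMap.compL ℝ E (E →L[ℝ] E) (E →L[ℝ] E)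
      (ContinuousLinearMap.compL ℝ E E E e)).comp (inversionTensor E)
    - ((ContinuousLinearMap.compL ℝ E E (E →L[ℝ] E)).flip e).comp (inversionTensor E)
    - (ContinuousLinearMap.compL ℝ E (E →L[ℝ] E) (E →L[ℝ] E)
      ((ContinuousLinearMap.compL ℝ E E E).flip e)).comp (inversionTensor E)
    + (inversionTensor E).comp f

theorem inversionTensorVariation_apply (e f : E →L[ℝ] E) (v x y : E) :
    inversionTensorVariation e f v x y = e (inversionTensor E v x y) - inversionTensor E v (e x) y
      - inversionTensor E v x (e y) + inversionTensor E (f v) x y := by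
  simp [inversionTensorVariation]

/-- The linearization at `inversionTensor` of the condition that the quadratic vector fields
`x ↦ P v x x` commute. -/
def LinearizedCommute (P : TriMap E) : Prop :=
  ∀ v w x : E, inversionTensor E v x (P w x x) - P w x (inversionTensor E v x x)
    + P v x (inversionTensor E w x x) - inversionTensor E w x (P v x x) = 0

/-- Conjugating by a linear map and reparametrizing the vector argument preserve commutation, so
tangent vectors to the orbit of `inversionTensor` solve the linearized relation. -/
theorem linearizedCommute_variation (e f : E →L[ℝ] E) :
    LinearizedCommute (inversionTensorVariation e f) := by
  intro v w x
  simp only [inversionTensorVariation_apply, inversionTensor_apply, map_sub, map_smul, map_add,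
    real_inner_comm]
  module

theorem LinearizedCommute.sub {P P' : TriMap E} (h : LinearizedCommute P)
    (h' : LinearizedCommute P') : LinearizedCommute (P - P') := by
  intro v w x
  have h1 := h v w x
  have h2 := h' v w x
  simp only [sub_apply, map_sub] at *
  linear_combination (norm := module) h1 - h2

/-- The diagonal case of the linearized commutation relation. -/
theorem LinearizedCommute.diag {P : TriMap E} (h : LinearizedCommute P) (x v : E) :
    ⟪x, x⟫ • P x x v = ⟪x, v⟫ • P x x x + ⟪x, P x x x⟫ • v - ⟪P x x x, v⟫ • x := by
  -- With `w = x` the two terms containing `P v` cancel, since `inversionTensor E x x` is the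
  -- homothety of ratio -⟪x, x⟫.
  have h1 := h v x x
  simp only [inversionTensor_apply, map_sub, map_smul, real_inner_comm] at h1 ⊢
  linear_combination (norm := module) -h1

/-- Polarization of `diag`: its derivative in `x` in the direction `z`. -/
theorem LinearizedCommute.diag_deriv {P : TriMap E} (h : LinearizedCommute P)
    (hs : ∀ v x y, P v x y = P v y x) (x z v : E) :
    (2 * ⟪x, z⟫) • P x x v + ⟪x, x⟫ • (P z x v + P x z v) =
      ⟪z, v⟫ • P x x x + ⟪x, v⟫ • (P z x x + (2 : ℝ) • P x x z)
      + (⟪z, P x x x⟫ + ⟪x, P z x x + (2 : ℝ) • P x x z⟫) • v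
      - ⟪P z x x + (2 : ℝ) • P x x z, v⟫ • x - ⟪P x x x, v⟫ • z := by
  have h1 := h.diag (x + z) v
  have h2 := h.diag (x - z) v
  have h3 := h.diag (x + (2 : ℝ) • z) v
  have h4 := h.diag (x - (2 : ℝ) • z) v
  have e1 : P x z x = P x x z := hs _ _ _
  have e2 : P z z x = P z x z := hs _ _ _
  have e3 : ⟪z, x⟫ = ⟪x, z⟫ := real_inner_comm _ _
  simp only [map_sub, map_smul, map_add, sub_apply,
    add_apply, smul_apply,
    inner_sub_left, inner_sub_right, inner_add_left, inner_add_right, real_inner_smul_left,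
    real_inner_smul_right, e1, e2, e3] at *
  -- The difference formula (8(f(1) - f(-1)) - (f(2) - f(-2)))/12 computes f'(0) exactly for
  -- polynomials of degree at most 4, the degree of both sides of `diag` in `x`.
  linear_combination (norm := module) (2 / 3 : ℝ) • (h1 - h2) - (1 / 12 : ℝ) • (h3 - h4)

section FiniteDimensional

variable [FiniteDimensional ℝ E]

open Module in
/-- The cubic map attached to a solution of the linearized commutation relation. -/
theorem LinearizedCommute.exists_cubic [Nontrivial E] {P : TriMap E} (h : LinearizedCommute P)
    (hs : ∀ v x y, P v x y = P v y x) :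
    ∃ e f : E →L[ℝ] E, ∀ x, P x x x = ⟪x, x⟫ • e x - (2 * ⟪x, f x⟫) • x := by
  let b := stdOrthonormalBasis ℝ E
  obtain ⟨N, hN⟩ : ∃ N : ℝ, N = finrank ℝ E := ⟨_, rfl⟩
  have hn : N ≠ 0 := by
    rw [hN]
    exact_mod_cast (finrank_pos (R := ℝ) (M := E)).ne'
  have hbb : ∀ i, ⟪b i, b i⟫ = 1 := fun i => by simp
  have hcard : ∀ r : ℝ, ∑ _i : Fin (finrank ℝ E), r = N * r := fun r => by simp [hN]
  have hcard' : ∀ r : E, ∑ _i : Fin (finrank ℝ E), r = N • r := fun r => by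
    simp [hN, ← Nat.cast_smul_eq_nsmul ℝ]
  have hrep : ∀ x, ∑ i, ⟪x, b i⟫ • b i = x := fun x => by
    simpa only [real_inner_comm] using b.sum_repr' x
  have hrepL : ∀ (T : E →L[ℝ] E) (x : E), ∑ i, ⟪x, b i⟫ • T (b i) = T x := fun T x => by
    conv_rhs => rw [← hrep x]
    simp
  -- `τ y z` is the trace of `P y z`; below, `δ x x` is the divergence at `x` of the cubic field `x
  -- ↦ P x x x`.
  let τ : E →ₗ[ℝ] E →ₗ[ℝ] ℝ := LinearMap.mk₂ ℝ (fun y z => ∑ i, ⟪P y z (b i), b i⟫)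
    (fun y y' z => by simp [inner_add_left, Finset.sum_add_distrib])
    (fun c y z => by simp [real_inner_smul_left, Finset.mul_sum])
    (fun y z z' => by simp [inner_add_left, Finset.sum_add_distrib])
    (fun c y z => by simp [real_inner_smul_left, Finset.mul_sum])
  let δ : E →ₗ[ℝ] E →ₗ[ℝ] ℝ := LinearMap.mk₂ ℝ
    (fun y z => ∑ i, (⟪P (b i) y z, b i⟫ + 2 * ⟪P y z (b i), b i⟫))
    (fun y y' z => by simp [inner_add_left, mul_add, Finset.sum_add_distrib]; ring)
    (fun c y z => by simp [real_inner_smul_left, Finset.mul_sum, mul_left_comm, mul_add])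
    (fun y z z' => by simp [inner_add_left, mul_add, Finset.sum_add_distrib]; ring)
    (fun c y z => by simp [real_inner_smul_left, Finset.mul_sum, mul_left_comm, mul_add])
  -- The trace in `v` of `diag_deriv`. On the right-hand side only the multiple of `v` survives; the
  -- four other terms cancel in pairs.
  have hτ : ∀ x z, (2 * ⟪x, z⟫) * τ x x + ⟪x, x⟫ * (τ z x + τ x z) =
      N * (⟪z, P x x x⟫ + ⟪x, P z x x + (2 : ℝ) • P x x z⟫) := by
    intro x z
    have h1 : ∀ i, (2 * ⟪x, z⟫) * ⟪P x x (b i), b i⟫ +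
        ⟪x, x⟫ * (⟪P z x (b i), b i⟫ + ⟪P x z (b i), b i⟫) =
        ⟪z, P x x x⟫ + ⟪x, P z x x + (2 : ℝ) • P x x z⟫ := fun i => by
      have := congrArg (fun w => ⟪w, b i⟫) (h.diag_deriv hs x z (b i))
      simp only [inner_add_left (𝕜 := ℝ), inner_sub_left (𝕜 := ℝ), real_inner_smul_left,
        hbb] at this
      linear_combination this
    have h2 := Finset.sum_congr (rfl : Finset.univ = Finset.univ) fun i _ => h1 i
    rw [hcard, Finset.sum_add_distrib, ← Finset.mul_sum, ← Finset.mul_sum,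
      Finset.sum_add_distrib] at h2
    exact h2
  let l : E →ₗ[ℝ] E := ((∑ i, ((P (b i)).flip (b i) + (P.flip (b i)).flip (b i)) : E →L[ℝ] E) : E →ₗ[ℝ] E)
  have hl : ∀ x, l x = ∑ i, (P (b i) x (b i) + P x (b i) (b i)) := fun x => by simp [l]
  let m : E →ₗ[ℝ] E := ∑ i, (τ (b i) + τ.flip (b i)).smulRight (b i)
  have hm : ∀ x, m x = ∑ i, (τ (b i) x + τ x (b i)) • b i := fun x => by simp [m]
  have key : ∀ x, (N ^ 2) • P x x x = ⟪x, x⟫ • (N • l x - m x) + (N * δ x x - 2 * τ x x) • x := by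
    intro x
    -- `diag_deriv` at `z = v = b i`, multiplied by `N`. The unknown scalar in front of `v` is
    -- eliminated by `hτ`, and the terms in `P x x (b i)` drop out. Summation over `i` then isolates
    -- `N ^ 2 • P x x x`.
    have h1 : ∀ i, (N * ⟪x, x⟫) • (P (b i) x (b i) + P x (b i) (b i)) =
        N • P x x x + N • ⟪x, b i⟫ • (P.flip x).flip x (b i) + (2 * τ x x) • ⟪x, b i⟫ • b i
        + ⟪x, x⟫ • (τ (b i) x + τ x (b i)) • b i
        - (N * (⟪P (b i) x x, b i⟫ + 2 * ⟪P x x (b i), b i⟫)) • x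
        - N • ⟪P x x x, b i⟫ • b i := fun i => by
      have h2 := h.diag_deriv hs x (b i) (b i)
      have h3 := hτ x (b i)
      have h4 : ⟪P (b i) x x + (2 : ℝ) • P x x (b i), b i⟫ =
          ⟪P (b i) x x, b i⟫ + 2 * ⟪P x x (b i), b i⟫ := by
        rw [inner_add_left, real_inner_smul_left]
      rw [hbb, h4] at h2
      have h5 := congrArg (fun t : ℝ => t • b i) h3
      simp only [ContinuousLinearMap.flip_apply] at h5 ⊢
      linear_combination (norm := module) N • h2 - h5
    have h2 := Finset.sum_congr (rfl : Finset.univ = Finset.univ) fun i _ => h1 i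
    simp only [Finset.sum_add_distrib, Finset.sum_sub_distrib, ← Finset.smul_sum,
      ← Finset.sum_smul, ← Finset.mul_sum, hcard', hrep, hrepL] at h2
    have h3 : δ x x = ∑ i, ⟪P (b i) x x, b i⟫ + 2 * ∑ i, ⟪P x x (b i), b i⟫ := by
      simp [δ, Finset.sum_add_distrib, Finset.mul_sum]
    rw [hl, hm, h3, Finset.sum_add_distrib]
    simp only [ContinuousLinearMap.flip_apply] at h2
    linear_combination (norm := module) -h2
  -- The endomorphism representing, up to the factor -2, the quadratic form that multiplies `x` in
  -- `key`.
  let f : E →ₗ[ℝ] E := (-(1 / 2) * (N ^ 2)⁻¹) •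
    ∑ j, ((N • δ - (2 : ℝ) • τ).flip (b j)).smulRight (b j)
  have hf : ∀ x, -(2 * ⟪x, f x⟫) = (N ^ 2)⁻¹ * (N * δ x x - 2 * τ x x) := by
    intro x
    have h1 : ∀ γ : E →ₗ[ℝ] ℝ, ∑ j, γ (b j) * ⟪x, b j⟫ = γ x := fun γ => by
      conv_rhs => rw [← hrep x]
      simp [mul_comm]
    have h2 := h1 ((N • δ - (2 : ℝ) • τ) x)
    have h3 : ⟪x, f x⟫ = (-(1 / 2) * (N ^ 2)⁻¹) *
        ∑ j, (N • δ - (2 : ℝ) • τ) x (b j) * ⟪x, b j⟫ := by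
      simp only [f, LinearMap.smul_apply, LinearMap.sum_apply, LinearMap.smulRight_apply,
        real_inner_smul_right, inner_sum, LinearMap.flip_apply]
    rw [h3, h2]
    simp only [LinearMap.sub_apply, LinearMap.smul_apply, smul_eq_mul]
    ring
  refine ⟨((N ^ 2)⁻¹ • (N • l - m)).toContinuousLinearMap, f.toContinuousLinearMap, fun x => ?_⟩
  have h1 := key x
  have h2 := hf x
  have h3 : P x x x = (N ^ 2)⁻¹ • (N ^ 2) • P x x x := (inv_smul_smul₀ (pow_ne_zero 2 hn) _).symm
  rw [h3, h1]
  simp only [LinearMap.coe_toContinuousLinearMap', sub_eq_add_neg, ← neg_smul, h2]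
  simp only [LinearMap.smul_apply, LinearMap.add_apply, LinearMap.neg_apply]
  module

/-- A variation can be chosen with the same cubic map as `P`. The difference has zero cubic map, so
`diag` makes it vanish on equal first two arguments. It is then antisymmetric in the first two
arguments and symmetric in the last two, hence zero. -/
theorem LinearizedCommute.eq_variation [Nontrivial E] {P : TriMap E} (h : LinearizedCommute P)
    (hs : ∀ v x y, P v x y = P v y x) : ∃ e f : E →L[ℝ] E, P = inversionTensorVariation e f := by
  obtain ⟨e, f, hc⟩ := h.exists_cubic hs
  -- The cubic map of the variation by (e', f') is ⟪x, x⟫(e' + f')x - 2⟪x, f' x⟫x, whence e' = e - f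
  -- and f' = f.
  refine ⟨e - f, f, ?_⟩
  have hR := h.sub (linearizedCommute_variation (e - f) f)
  obtain ⟨R, hR'⟩ : ∃ R, R = P - inversionTensorVariation (e - f) f := ⟨_, rfl⟩
  rw [← hR'] at hR
  have hRs : ∀ v x y, R v x y = R v y x := fun v x y => by
    simp only [hR', sub_apply, inversionTensorVariation_apply, inversionTensor_apply, hs v x y,
      real_inner_comm]
    simp only [map_sub, map_smul]
    module
  have hRc : ∀ x, R x x x = 0 := fun x => by
    simp only [hR', sub_apply, inversionTensorVariation_apply, inversionTensor_apply, hc,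
      real_inner_comm]
    simp only [map_sub, map_smul, inner_sub_right]
    module
  have hR2 : ∀ x v, R x x v = 0 := fun x v => by
    have h1 := hR.diag x v
    simp only [hRc, smul_zero, inner_zero_right, inner_zero_left, zero_smul, add_zero,
      sub_zero] at h1
    rcases smul_eq_zero.mp h1 with h2 | h2
    · rw [inner_self_eq_zero.mp h2]; simp
    · exact h2
  have hR3 : ∀ x y v, R x y v = - R y x v := fun x y v => by
    have h1 := hR2 (x + y) v
    simp only [map_add, add_apply, hR2, zero_add, add_zero] at h1
    exact eq_neg_of_add_eq_zero_right h1
  have hR0 : R = 0 := by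
    ext x y v : 3
    have h1 : R x y v = - R x y v := by
      calc R x y v = - R y x v := hR3 _ _ _
        _ = - R y v x := by rw [hRs]
        _ = R v y x := by rw [hR3 y v, neg_neg]
        _ = R v x y := hRs _ _ _
        _ = - R x v y := hR3 _ _ _
        _ = - R x y v := by rw [hRs]
    have h2 : (2 : ℝ) • R x y v = 0 := by
      rw [two_smul]
      exact add_eq_zero_iff_eq_neg.mpr h1
    simpa using h2
  rw [hR0] at hR'
  exact sub_eq_zero.mp hR'.symm

end FiniteDimensional

end InversionTensor

/-! ### Local rigidity of commuting quadratic families: slice and compactness. -/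

section Rigidity

set_option maxSynthPendingDepth 3

open scoped RealInnerProductSpace

variable {E : Type*} [NormedAddCommGroup E] [InnerProductSpace ℝ E]

/-- All the bilinear maps of the family are symmetric. -/
def TriMap.IsSymm (Q : TriMap E) : Prop := ∀ v x y : E, Q v x y = Q v y x

/-- The quadratic vector fields `x ↦ Q v x x` commute. -/
def TriMap.Commutes (Q : TriMap E) : Prop := ∀ v w x : E, Q v x (Q w x x) = Q w x (Q v x x)

theorem inversionTensor_isSymm : (inversionTensor E).IsSymm := by
  intro v x y
  simp only [inversionTensor_apply, real_inner_comm]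
  module

theorem inversionTensor_commutes : (inversionTensor E).Commutes := by
  intro v w x
  simp only [inversionTensor_apply, real_inner_comm, map_sub, map_smul]
  module

/-- The family of bilinear maps `(x, y) ↦ L (c (M v) (N x) (N y))`. -/
noncomputable def TriMap.transform (L M N : E →L[ℝ] E) (c : TriMap E) : TriMap E :=
  ((ContinuousLinearMap.compL ℝ E (E →L[ℝ] E) (E →L[ℝ] E)
    ((ContinuousLinearMap.compL ℝ E E E L).comp ((ContinuousLinearMap.compL ℝ E E E).flip N))).comp
    ((ContinuousLinearMap.compL ℝ E E (E →L[ℝ] E)).flip N)).comp (c.comp M)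

@[simp]
theorem TriMap.transform_apply (L M N : E →L[ℝ] E) (c : TriMap E) (v x y : E) :
    c.transform L M N v x y = L (c (M v) (N x) (N y)) := by
  simp [TriMap.transform]

theorem TriMap.transform_one (c : TriMap E) : c.transform 1 1 1 = c := by
  ext v x y
  simp

theorem TriMap.transform_units_inv (L M : (E →L[ℝ] E)ˣ) (c : TriMap E) (v x y : E) :
    c v x y = (↑L⁻¹ : E →L[ℝ] E) (c.transform L M (↑L⁻¹ : E →L[ℝ] E)
      ((↑M⁻¹ : E →L[ℝ] E) v) ((L : E →L[ℝ] E) x) ((L : E →L[ℝ] E) y)) := by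
  have h : ∀ (u : (E →L[ℝ] E)ˣ) (z : E),
      (↑u⁻¹ : E →L[ℝ] E) ((u : E →L[ℝ] E) z) = z := fun u z => by
    rw [← mul_apply_eq_comp, Units.inv_mul, one_apply_eq_self]
  have h' : ∀ (u : (E →L[ℝ] E)ˣ) (z : E),
      (u : E →L[ℝ] E) ((↑u⁻¹ : E →L[ℝ] E) z) = z := fun u z => by
    rw [← mul_apply_eq_comp, Units.mul_inv, one_apply_eq_self]
  rw [TriMap.transform_apply, h, h, h, h']

theorem TriMap.IsSymm.of_transform {L M : (E →L[ℝ] E)ˣ} {c : TriMap E}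
    (h : (c.transform L M (↑L⁻¹ : E →L[ℝ] E)).IsSymm) : c.IsSymm := by
  intro v x y
  rw [c.transform_units_inv L M v x y, c.transform_units_inv L M v y x, h]

theorem TriMap.Commutes.of_transform {L M : (E →L[ℝ] E)ˣ} {c : TriMap E}
    (h : (c.transform L M (↑L⁻¹ : E →L[ℝ] E)).Commutes) : c.Commutes := by
  intro v w x
  have h' : ∀ z : E, (L : E →L[ℝ] E) ((↑L⁻¹ : E →L[ℝ] E) z) = z := fun z => by
    rw [← mul_apply_eq_comp, Units.mul_inv, one_apply_eq_self]
  rw [c.transform_units_inv L M v x (c w x x), c.transform_units_inv L M w x (c v x x),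
    c.transform_units_inv L M w x x, c.transform_units_inv L M v x x, h', h', h]

variable [FiniteDimensional ℝ E]

/-- Blow-up: if `c = s • u` with `s = ‖c‖`, dividing the commutation relation by `s` gives a
relation on the unit vector `u` that degenerates to the linearized one at `s = 0`. That limit has no
unit solution in `C`, and compactness of the sphere excludes solutions for small `s`. -/
theorem eventually_eq_zero_of_commutes (C : Submodule ℝ (TriMap E))
    (hC : ∀ c ∈ C, c.IsSymm → LinearizedCommute c → c = 0) :
    ∀ᶠ c in 𝓝 (0 : TriMap E), c ∈ C → (inversionTensor E + c).IsSymm →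
      (inversionTensor E + c).Commutes → c = 0 := by
  have : ProperSpace (TriMap E) := FiniteDimensional.proper_real _
  -- The rescaled relation, with `s` as a parameter that may be 0; closedness of `Z` is what the
  -- compactness argument uses.
  let Z : Set (ℝ × TriMap E) := {p | p.2 ∈ C ∧ p.2.IsSymm ∧ ∀ v w x : E,
    inversionTensor E v x (p.2 w x x) - p.2 w x (inversionTensor E v x x)
    + p.2 v x (inversionTensor E w x x) - inversionTensor E w x (p.2 v x x)
    + p.1 • (p.2 v x (p.2 w x x) - p.2 w x (p.2 v x x)) = 0}
  have hZ : IsClosed Z := by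
    refine IsClosed.inter ?_ (IsClosed.inter ?_ ?_)
    · exact C.closed_of_finiteDimensional.preimage continuous_snd
    · have : {p : ℝ × TriMap E | p.2.IsSymm} =
          ⋂ v, ⋂ x, ⋂ y, {p : ℝ × TriMap E | p.2 v x y = p.2 v y x} := by
        ext p
        simp [TriMap.IsSymm]
      change IsClosed {p : ℝ × TriMap E | p.2.IsSymm}
      rw [this]
      refine isClosed_iInter fun v => isClosed_iInter fun x => isClosed_iInter fun y => ?_
      exact isClosed_eq (by fun_prop) (by fun_prop)
    · have : {p : ℝ × TriMap E | ∀ v w x : E,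
          inversionTensor E v x (p.2 w x x) - p.2 w x (inversionTensor E v x x)
          + p.2 v x (inversionTensor E w x x) - inversionTensor E w x (p.2 v x x)
          + p.1 • (p.2 v x (p.2 w x x) - p.2 w x (p.2 v x x)) = 0} =
          ⋂ v, ⋂ w, ⋂ x, {p : ℝ × TriMap E |
          inversionTensor E v x (p.2 w x x) - p.2 w x (inversionTensor E v x x)
          + p.2 v x (inversionTensor E w x x) - inversionTensor E w x (p.2 v x x)
          + p.1 • (p.2 v x (p.2 w x x) - p.2 w x (p.2 v x x)) = 0} := by
        ext p
        simp
      refine (congrArg IsClosed this).mpr ?_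
      refine isClosed_iInter fun v => isClosed_iInter fun x => isClosed_iInter fun y => ?_
      exact isClosed_eq (by fun_prop) (by fun_prop)
  have h1 : ∀ᶠ s in 𝓝 (0 : ℝ), ∀ u ∈ Metric.sphere (0 : TriMap E) 1, (s, u) ∉ Z := by
    refine (isCompact_sphere _ _).eventually_forall_of_forall_eventually
      (P := fun s u => (s, u) ∉ Z) fun u hu => ?_
    refine hZ.isOpen_compl.mem_nhds ?_
    rintro ⟨hu1, hu2, hu3⟩
    have : u = 0 := hC u hu1 hu2 fun v w x => by simpa using hu3 v w x
    simp [this] at hu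
  have h2 : Tendsto (fun c : TriMap E => ‖c‖) (𝓝 0) (𝓝 0) := by
    simpa using (continuous_norm (E := TriMap E)).tendsto 0
  filter_upwards [h2.eventually h1] with c hc hcC hcs hcc
  by_contra h0
  have hn : ‖c‖ ≠ 0 := norm_ne_zero_iff.mpr h0
  obtain ⟨u, hu⟩ : ∃ u, u = ‖c‖⁻¹ • c := ⟨_, rfl⟩
  have hcu : c = ‖c‖ • u := by rw [hu, smul_inv_smul₀ hn]
  refine hc u ?_ ⟨?_, ?_, ?_⟩
  · simp [hu, norm_smul, hn]
  · rw [hu]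
    exact C.smul_mem _ hcC
  · intro v x y
    have h3 := hcs v x y
    simp only [add_apply, inversionTensor_isSymm v x y, add_right_inj] at h3
    simp [hu, h3]
  · intro v w x
    have h3 := hcc v w x
    have h4 := inversionTensor_commutes v w x
    have h5 : ‖c‖ • (inversionTensor E v x (u w x x) - u w x (inversionTensor E v x x)
        + u v x (inversionTensor E w x x) - inversionTensor E w x (u v x x)
        + ‖c‖ • (u v x (u w x x) - u w x (u v x x))) = 0 := by
      obtain ⟨s, hs⟩ : ∃ s, s = ‖c‖ := ⟨_, rfl⟩
      rw [← hs] at hcu ⊢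
      rw [hcu] at h3
      simp only [add_apply, smul_apply, map_add, map_smul] at h3
      linear_combination (norm := module) h3 - h4
    exact (smul_eq_zero.mp h5).resolve_left hn

section Slice

variable {V : Type*} [NormedAddCommGroup V] [NormedSpace ℝ V]

theorem contDiffAt_transform (j : V →L[ℝ] TriMap E) :
    ContDiffAt ℝ 1 (fun p : (E →L[ℝ] E) × (E →L[ℝ] E) × V =>
      (inversionTensor E + j p.2.2).transform p.1 p.2.1 (Ring.inverse p.1)) (1, 1, 0) := by
  have h1 : ContDiffAt ℝ 1 (fun p : (E →L[ℝ] E) × (E →L[ℝ] E) × V => Ring.inverse p.1) (1, 1, 0) :=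
    (contDiffAt_ringInverse ℝ (1 : (E →L[ℝ] E)ˣ)).comp
      ((1, 1, 0) : (E →L[ℝ] E) × (E →L[ℝ] E) × V) contDiffAt_fst
  unfold TriMap.transform
  fun_prop

/-- Differentiability comes from the composition of smooth operations; the value of the derivative
is then identified after evaluation at three vectors. -/
theorem hasDerivAt_transform (e f : E →L[ℝ] E) (c : TriMap E) :
    HasDerivAt (fun t : ℝ => (inversionTensor E + t • c).transform (1 + t • e) (1 + t • f)
      (Ring.inverse (1 + t • e))) (inversionTensorVariation e f + c) 0 := by
  have hlin : ∀ {F : Type _} [NormedAddCommGroup F] [NormedSpace ℝ F] (u w : F),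
      HasDerivAt (fun t : ℝ => u + t • w) w 0 := fun u w => by
    simpa using ((hasDerivAt_id (0 : ℝ)).smul_const w).const_add u
  have hL := hlin (1 : E →L[ℝ] E) e
  have hM := hlin (1 : E →L[ℝ] E) f
  have hN : HasDerivAt (fun t : ℝ => Ring.inverse (1 + t • e)) (-e) 0 := by
    have h1 : HasFDerivAt (Ring.inverse : (E →L[ℝ] E) → _)
        (-ContinuousLinearMap.mulLeftRight ℝ (E →L[ℝ] E) 1 1) (1 + (0 : ℝ) • e) := by
      simpa using hasFDerivAt_ringInverse (𝕜 := ℝ) (1 : (E →L[ℝ] E)ˣ)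
    have h2 : HasDerivAt (fun t : ℝ => Ring.inverse (1 + t • e))
        ((-ContinuousLinearMap.mulLeftRight ℝ (E →L[ℝ] E) 1 1) e) 0 := by
      have h3 := h1.comp_hasDerivAt (0 : ℝ) hL
      exact h3
    have h3 : (-ContinuousLinearMap.mulLeftRight ℝ (E →L[ℝ] E) 1 1) e = -e := by simp
    rwa [h3] at h2
  have hd : DifferentiableAt ℝ (fun t : ℝ => (inversionTensor E + t • c).transform (1 + t • e)
      (1 + t • f) (Ring.inverse (1 + t • e))) 0 := by
    have := hN.differentiableAt
    unfold TriMap.transform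
    fun_prop
  obtain ⟨D, hD⟩ : ∃ D : TriMap E, HasDerivAt (fun t : ℝ => (inversionTensor E + t • c).transform
      (1 + t • e) (1 + t • f) (Ring.inverse (1 + t • e))) D 0 := ⟨_, hd.hasDerivAt⟩
  suffices inversionTensorVariation e f + c = D by rwa [this]
  ext v x y
  have h2 := (((ContinuousLinearMap.apply ℝ E y).comp
    ((ContinuousLinearMap.apply ℝ (E →L[ℝ] E) x).comp
    (ContinuousLinearMap.apply ℝ (E →L[ℝ] E →L[ℝ] E) v))).hasFDerivAt
      (x := (inversionTensor E + (0 : ℝ) • c).transform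
      (1 + (0 : ℝ) • e) (1 + (0 : ℝ) • f) (Ring.inverse (1 + (0 : ℝ) • e)))).comp_hasDerivAt 0 hD
  have h3 := hL.clm_apply ((((hlin (inversionTensor E) c).clm_apply
    (hM.clm_apply (hasDerivAt_const (0 : ℝ) v))).clm_apply
    (hN.clm_apply (hasDerivAt_const (0 : ℝ) x))).clm_apply
    (hN.clm_apply (hasDerivAt_const (0 : ℝ) y)))
  have h5 : HasDerivAt (fun t : ℝ => (inversionTensor E + t • c).transform
      (1 + t • e) (1 + t • f) (Ring.inverse (1 + t • e)) v x y) (D v x y) 0 := h2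
  simp only [TriMap.transform_apply] at h5
  have h4 := h3.unique h5
  simp only [zero_smul, add_zero, Ring.inverse_one, one_apply_eq_self, map_zero, add_apply,
    neg_apply, map_neg] at h4
  rw [← h4, add_apply, add_apply, add_apply, inversionTensorVariation_apply]
  abel

/-- Surjectivity of the differential, which is the hypothesis `hj`, makes the parametrization by
`L`, `M` and the slice parameter open at the base point. `Ring.inverse` keeps it defined for all `L`
and smooth near 1. -/
theorem map_transform_nhds [CompleteSpace V] (j : V →L[ℝ] TriMap E)
    (hj : ∀ T : TriMap E, ∃ e f c, inversionTensorVariation e f + j c = T) :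
    map (fun p : (E →L[ℝ] E) × (E →L[ℝ] E) × V =>
      (inversionTensor E + j p.2.2).transform p.1 p.2.1 (Ring.inverse p.1)) (𝓝 (1, 1, 0))
      = 𝓝 (inversionTensor E) := by
  obtain ⟨Ψ, hΨ0⟩ : ∃ Ψ : (E →L[ℝ] E) × (E →L[ℝ] E) × V → TriMap E, Ψ = fun p =>
      (inversionTensor E + j p.2.2).transform p.1 p.2.1 (Ring.inverse p.1) := ⟨_, rfl⟩
  have hΨ : HasStrictFDerivAt Ψ (fderiv ℝ Ψ (1, 1, 0)) (1, 1, 0) := by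
    rw [hΨ0]
    exact (contDiffAt_transform j).hasStrictFDerivAt one_ne_zero
  have hΨ' : ∀ (e f : E →L[ℝ] E) (c : V),
      fderiv ℝ Ψ (1, 1, 0) (e, f, c) = inversionTensorVariation e f + j c := fun e f c => by
    have h1 := hΨ.hasFDerivAt.hasLineDerivAt (e, f, c)
    refine HasDerivAt.unique h1 ((hasDerivAt_transform e f (j c)).congr_of_eventuallyEq
      (Eventually.of_forall fun t => ?_))
    simp [hΨ0]
  have hsurj : (fderiv ℝ Ψ (1, 1, 0)).range = ⊤ := by
    rw [eq_top_iff]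
    rintro T -
    obtain ⟨e, f, c, hT⟩ := hj T
    exact ⟨(e, f, c), (hΨ' e f c).trans hT⟩
  have hmap := hΨ.map_nhds_eq_of_surj hsurj
  have h1 : Ψ (1, 1, 0) = inversionTensor E := by simp [hΨ0, TriMap.transform_one]
  rwa [h1, hΨ0] at hmap

theorem eventually_eq_transform [CompleteSpace V] (j : V →L[ℝ] TriMap E)
    (hj : ∀ T : TriMap E, ∃ e f c, inversionTensorVariation e f + j c = T) {p : V → Prop}
    (hp : ∀ᶠ c in 𝓝 0, p c) : ∀ᶠ Q in 𝓝 (inversionTensor E), ∃ (L M : (E →L[ℝ] E)ˣ) (c : V),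
      p c ∧ Q = (inversionTensor E + j c).transform L M (↑L⁻¹ : E →L[ℝ] E) := by
  rw [← map_transform_nhds j hj, eventually_map]
  have hu : ∀ᶠ L in 𝓝 (1 : E →L[ℝ] E), IsUnit L := Units.isOpen.mem_nhds isUnit_one
  have e1 : Tendsto (fun p : (E →L[ℝ] E) × (E →L[ℝ] E) × V => p.1) (𝓝 (1, 1, 0)) (𝓝 1) :=
    continuous_fst.tendsto _
  have e2 : Tendsto (fun p : (E →L[ℝ] E) × (E →L[ℝ] E) × V => p.2.1) (𝓝 (1, 1, 0)) (𝓝 1) :=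
    (continuous_fst.comp continuous_snd).tendsto _
  have e3 : Tendsto (fun p : (E →L[ℝ] E) × (E →L[ℝ] E) × V => p.2.2) (𝓝 (1, 1, 0)) (𝓝 0) :=
    (continuous_snd.comp continuous_snd).tendsto _
  filter_upwards [e1.eventually hu, e2.eventually hu, e3.eventually hp]
  rintro ⟨L, M, c⟩ ⟨L, rfl⟩ ⟨M, rfl⟩ hc
  exact ⟨L, M, c, hc, by simp only [Ring.inverse_unit]⟩

end Slice

/-- `inversionTensorVariation` as a linear map. -/
noncomputable def inversionTensorVariationₗ (E : Type*) [NormedAddCommGroup E]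
    [InnerProductSpace ℝ E] : ((E →L[ℝ] E) × (E →L[ℝ] E)) →ₗ[ℝ] TriMap E where
  toFun p := inversionTensorVariation p.1 p.2
  map_add' p q := by
    ext v x y
    simp only [inversionTensorVariation_apply, inversionTensor_apply, add_apply, Prod.fst_add,
      Prod.snd_add, inner_add_left, inner_add_right]
    module
  map_smul' r p := by
    ext v x y
    simp only [inversionTensorVariation_apply, inversionTensor_apply, smul_apply, Prod.smul_fst,
      Prod.smul_snd, real_inner_smul_left, real_inner_smul_right, RingHom.id_apply]
    module

/-- With a slice complementary to the tangent space of the orbit, every nearby family is a transform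
of `inversionTensor + c` with `c` small in the slice. Symmetry and commutation are inherited by
`inversionTensor + c`, and they force `c = 0`. -/
theorem eventually_exists_equiv [Nontrivial E] : ∀ᶠ Q in 𝓝 (inversionTensor E),
    Q.IsSymm → Q.Commutes → ∃ L M : E ≃L[ℝ] E,
      ∀ v x y, Q v x y = L (inversionTensor E (M v) (L.symm x) (L.symm y)) := by
  obtain ⟨C, hC⟩ := Submodule.exists_isCompl (LinearMap.range (inversionTensorVariationₗ E))
  have hC0 : ∀ c ∈ C, c.IsSymm → LinearizedCommute c → c = 0 := fun c hc hs hl => by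
    obtain ⟨e, f, hef⟩ := hl.eq_variation hs
    exact (Submodule.disjoint_def.mp hC.disjoint) c ⟨(e, f), hef.symm⟩ hc
  -- A linear projection onto `C`, so that the slice is parametrized by all of `TriMap E` through
  -- `j`.
  obtain ⟨g, hg⟩ := LinearMap.exists_extend (LinearMap.id : C →ₗ[ℝ] C)
  obtain ⟨j, hj⟩ : ∃ j : TriMap E →L[ℝ] TriMap E, ∀ T, j T = (g T : TriMap E) :=
    ⟨(C.subtype ∘ₗ g).toContinuousLinearMap, fun T => rfl⟩
  have hsurj : ∀ T : TriMap E, ∃ e f c, inversionTensorVariation e f + j c = T := fun T => by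
    have hT : T ∈ LinearMap.range (inversionTensorVariationₗ E) ⊔ C := by
      rw [hC.sup_eq_top]
      exact Submodule.mem_top
    obtain ⟨_, ⟨⟨e, f⟩, rfl⟩, c, hc, rfl⟩ := Submodule.mem_sup.mp hT
    refine ⟨e, f, c, ?_⟩
    have h1 : g c = ⟨c, hc⟩ := LinearMap.congr_fun hg ⟨c, hc⟩
    rw [hj, h1]
    rfl
  have hp : ∀ᶠ c in 𝓝 (0 : TriMap E), (inversionTensor E + j c).IsSymm →
      (inversionTensor E + j c).Commutes → j c = 0 := by
    have h1 : Tendsto j (𝓝 0) (𝓝 0) := by simpa only [map_zero] using j.continuous.tendsto 0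
    filter_upwards [h1.eventually (eventually_eq_zero_of_commutes C hC0)] with c hc
    exact hc (by rw [hj]; exact (g c).2)
  filter_upwards [eventually_eq_transform j hsurj hp]
  rintro Q ⟨L, M, c, hc, rfl⟩ hs hcomm
  refine ⟨ContinuousLinearEquiv.ofUnit L, ContinuousLinearEquiv.ofUnit M, fun v x y => ?_⟩
  rw [hc hs.of_transform hcomm.of_transform, add_zero, TriMap.transform_apply]
  rfl

end Rigidity

/-! ### Rigidity of the linear parts. -/

section LinearParts

set_option maxSynthPendingDepth 3

open scoped RealInnerProductSpace

/-- Factor Cᵏ - 1 = S(C - 1) with S = 1 + C + ⋯ + Cᵏ⁻¹. Then A(C - 1) = S(C - 1)A, where A is nearly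
r and S nearly k, so (k - 1)r‖C - 1‖ is bounded by a small multiple of ‖C - 1‖. -/
theorem eventually_eq_one_of_mul_eq_pow_mul {R : Type*} [NormedRing R] [NormedAlgebra ℝ R] {k : ℕ}
    (hk : 2 ≤ k) {r : ℝ} (hr : 0 < r) :
    ∀ᶠ p in 𝓝 ((r • 1, 1) : R × R), p.1 * p.2 = p.2 ^ k * p.1 → p.2 = 1 := by
  have hk' : (2 : ℝ) ≤ k := by exact_mod_cast hk
  have hc : ContinuousAt (fun p : R × R => ‖(k : R) - ∑ i ∈ Finset.range k, p.2 ^ i‖ * r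
      + ‖∑ i ∈ Finset.range k, p.2 ^ i‖ * ‖r • 1 - p.1‖ + ‖p.1 - r • 1‖) (r • 1, 1) := by
    fun_prop
  have h0 : ∀ᶠ p in 𝓝 ((r • 1, 1) : R × R), ‖(k : R) - ∑ i ∈ Finset.range k, p.2 ^ i‖ * r
      + ‖∑ i ∈ Finset.range k, p.2 ^ i‖ * ‖r • 1 - p.1‖ + ‖p.1 - r • 1‖ < (k - 1) * r := by
    refine hc.eventually (gt_mem_nhds ?_)
    simp only [one_pow, Finset.sum_const, Finset.card_range, nsmul_eq_mul, mul_one, sub_self,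
      norm_zero, zero_mul, mul_zero, add_zero]
    exact mul_pos (by linarith) hr
  filter_upwards [h0]
  rintro ⟨A, C⟩ hlt hAC
  simp only at hlt hAC ⊢
  obtain ⟨S, hS⟩ : ∃ S, S = ∑ i ∈ Finset.range k, C ^ i := ⟨_, rfl⟩
  rw [← hS] at hlt
  have h1 : A * (C - 1) = S * (C - 1) * A := by
    rw [hS, geom_sum_mul, mul_sub, sub_mul, hAC, mul_one, one_mul]
  have h2 : (((k : ℝ) - 1) * r) • (C - 1) = r • (((k : R) - S) * (C - 1))
      + S * (C - 1) * (r • 1 - A) + (A - r • 1) * (C - 1) := by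
    have h3 : (k : R) * (C - 1) = (k : ℝ) • (C - 1) := by
      rw [← nsmul_eq_mul, Nat.cast_smul_eq_nsmul]
    rw [sub_mul (k : R), h3, sub_mul A, h1, mul_sub (S * (C - 1)), mul_smul_comm, smul_mul_assoc,
      mul_one, one_mul]
    module
  have h4 := congrArg norm h2
  rw [norm_smul, Real.norm_of_nonneg (by nlinarith)] at h4
  have h5 : ‖r • (((k : R) - S) * (C - 1)) + S * (C - 1) * (r • 1 - A) + (A - r • 1) * (C - 1)‖ ≤
      r * (‖(k : R) - S‖ * ‖C - 1‖) + ‖S‖ * ‖C - 1‖ * ‖r • 1 - A‖ + ‖A - r • 1‖ * ‖C - 1‖ := by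
    refine (norm_add_le _ _).trans (add_le_add ((norm_add_le _ _).trans (add_le_add ?_ ?_))
      (norm_mul_le _ _))
    · rw [norm_smul, Real.norm_of_nonneg hr.le]
      exact mul_le_mul_of_nonneg_left (norm_mul_le _ _) hr.le
    · exact (norm_mul_le _ _).trans (mul_le_mul_of_nonneg_right (norm_mul_le _ _) (norm_nonneg _))
  by_contra hne
  have hpos : 0 < ‖C - 1‖ := norm_pos_iff.mpr (sub_ne_zero.mpr hne)
  have h6 := mul_lt_mul_of_pos_right hlt hpos
  nlinarith

variable {E : Type*} [NormedAddCommGroup E] [InnerProductSpace ℝ E]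

/-- Put `v = x` and A = k⁻¹ + D. As `inversionTensor x x` is -‖x‖²·id, the part linear in D is
-‖x‖²Dx on the left and -2‖x‖²Dx on the right; thus ‖x‖²Dx equals error terms that are small
relative to D. -/
theorem eventually_eq_smul_one_of_equivariant {k : ℕ} (hk : 2 ≤ k) :
    ∀ᶠ p in 𝓝 (((k : ℝ)⁻¹ • 1, inversionTensor E) : (E →L[ℝ] E) × TriMap E),
      (∀ v x, p.1 (p.2 v x x) = (k : ℝ) • p.2 v (p.1 x) (p.1 x)) → p.1 = (k : ℝ)⁻¹ • 1 := by
  have hk0 : (k : ℝ) ≠ 0 := by positivity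
  have hc : Continuous (fun p : (E →L[ℝ] E) × TriMap E =>
      3 * ‖p.2 - inversionTensor E‖ + k * ‖p.2‖ * ‖p.1 - (k : ℝ)⁻¹ • 1‖) := by
    fun_prop
  have h0 : ∀ᶠ p in 𝓝 (((k : ℝ)⁻¹ • 1, inversionTensor E) : (E →L[ℝ] E) × TriMap E),
      3 * ‖p.2 - inversionTensor E‖ + k * ‖p.2‖ * ‖p.1 - (k : ℝ)⁻¹ • 1‖ < 1 :=
    hc.continuousAt.eventually (gt_mem_nhds (by simp))
  filter_upwards [h0]
  rintro ⟨A, Q⟩ hlt hA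
  simp only at hlt hA ⊢
  obtain ⟨R, hR⟩ : ∃ R, R = Q - inversionTensor E := ⟨_, rfl⟩
  obtain ⟨D, hD⟩ : ∃ D, D = A - (k : ℝ)⁻¹ • 1 := ⟨_, rfl⟩
  rw [← hR, ← hD] at hlt
  have key : ∀ x, ‖x‖ ^ 2 * ‖D x‖ ≤ ‖x‖ ^ 2 *
      ((3 * ‖R‖ + k * ‖Q‖ * ‖D‖) * ‖D‖ * ‖x‖) := by
    intro x
    have hAx : A x = (k : ℝ)⁻¹ • x + D x := by simp [hD]
    have hQ : ∀ y z, Q x y z = inversionTensor E x y z + R x y z := fun y z => by simp [hR]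
    have h1 := hA x x
    have h2 : A (Q x x x) = (k : ℝ)⁻¹ • Q x x x + D (Q x x x) := by simp [hD]
    rw [h2, hAx] at h1
    have h3 : (k : ℝ) • Q x ((k : ℝ)⁻¹ • x + D x) ((k : ℝ)⁻¹ • x + D x) =
        (k : ℝ)⁻¹ • Q x x x + Q x x (D x) + Q x (D x) x + (k : ℝ) • Q x (D x) (D x) := by
      simp only [map_add, add_apply, map_smul, smul_apply, smul_add]
      simp only [smul_smul, mul_inv_cancel₀ hk0, mul_inv_cancel_left₀ hk0]
      module
    rw [h3] at h1
    have h4 : ‖x‖ ^ 2 • D x = R x x (D x) + R x (D x) x - D (R x x x)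
        + (k : ℝ) • Q x (D x) (D x) := by
      rw [hQ x x, hQ x (D x), hQ (D x) x] at h1
      simp only [inversionTensor_apply, real_inner_comm, map_sub, map_add, map_smul,
        real_inner_self_eq_norm_sq] at h1 ⊢
      linear_combination (norm := module) h1
    have h5 : ‖‖x‖ ^ 2 • D x‖ = ‖x‖ ^ 2 * ‖D x‖ := by
      rw [norm_smul, norm_pow, norm_norm]
    have hb : ∀ (T : TriMap E) (y z w : E), ‖T y z w‖ ≤ ‖T‖ * ‖y‖ * ‖z‖ * ‖w‖ := fun T y z w =>
      (T y z).le_of_opNorm_le ((T y).le_of_opNorm_le (T.le_opNorm y) z) w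
    have hDx := D.le_opNorm x
    rw [← h5, h4]
    have n1 : ‖R x x (D x)‖ ≤ ‖R‖ * ‖x‖ * ‖x‖ * (‖D‖ * ‖x‖) := (hb R _ _ _).trans (by gcongr)
    have n2 : ‖R x (D x) x‖ ≤ ‖R‖ * ‖x‖ * (‖D‖ * ‖x‖) * ‖x‖ := (hb R _ _ _).trans (by gcongr)
    have n3 : ‖D (R x x x)‖ ≤ ‖D‖ * (‖R‖ * ‖x‖ * ‖x‖ * ‖x‖) :=
      (D.le_opNorm _).trans (by gcongr; exact hb R _ _ _)
    have n4 : ‖(k : ℝ) • Q x (D x) (D x)‖ ≤ k * (‖Q‖ * ‖x‖ * (‖D‖ * ‖x‖) * (‖D‖ * ‖x‖)) := by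
      rw [norm_smul, Real.norm_natCast]
      gcongr
      exact (hb Q _ _ _).trans (by gcongr)
    calc _ ≤ ‖R x x (D x)‖ + ‖R x (D x) x‖ + ‖D (R x x x)‖ + ‖(k : ℝ) • Q x (D x) (D x)‖ :=
          (norm_add_le _ _).trans (add_le_add_left ((norm_sub_le _ _).trans
            (add_le_add_left (norm_add_le _ _) _)) _)
      _ ≤ _ := add_le_add (add_le_add (add_le_add n1 n2) n3) n4
      _ = _ := by ring
  have hle : ‖D‖ ≤ (3 * ‖R‖ + k * ‖Q‖ * ‖D‖) * ‖D‖ := by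
    refine D.opNorm_le_bound (by positivity) fun x => ?_
    by_cases hx : x = 0
    · simp [hx]
    · have : 0 < ‖x‖ ^ 2 := by positivity
      exact le_of_mul_le_mul_left (key x) this
  have hD0 : ‖D‖ = 0 := by
    by_contra hne
    have hpos : 0 < ‖D‖ := lt_of_le_of_ne (norm_nonneg _) (Ne.symm hne)
    have := mul_lt_mul_of_pos_right hlt hpos
    linarith
  rw [norm_eq_zero, hD, sub_eq_zero] at hD0
  exact hD0

end LinearParts

/-! ### Convergence of the linearizer of a homothetic contraction. -/

section Linearization

universe u

variable {E : Type u} [NormedAddCommGroup E] [NormedSpace ℝ E]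

theorem ContDiffAt.exists_norm_sub_le_sq {F : Type*} [NormedAddCommGroup F] [NormedSpace ℝ F]
    {f : E → F} (hf : ContDiffAt ℝ 2 f 0) :
    ∃ C, 0 ≤ C ∧ ∀ᶠ x in 𝓝 (0 : E), ‖f x - f 0 - fderiv ℝ f 0 x‖ ≤ C * ‖x‖ ^ 2 := by
  have h1 : ContDiffAt ℝ 1 (fderiv ℝ f) 0 := hf.fderiv_right (by norm_num)
  obtain ⟨K, t, ht, hK⟩ := h1.exists_lipschitzOnWith
  have hd : ∀ᶠ x in 𝓝 (0 : E), DifferentiableAt ℝ f x :=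
    (hf.eventually (by simp)).mono fun x hx => hx.differentiableAt (by simp)
  obtain ⟨ε, hε, hball⟩ := Metric.eventually_nhds_iff_ball.mp (hd.and ht)
  refine ⟨K, K.2, Metric.eventually_nhds_iff_ball.mpr ⟨ε, hε, fun x hx => ?_⟩⟩
  have h0 : (0 : E) ∈ t := mem_of_mem_nhds ht
  have hsub : ∀ y ∈ Metric.closedBall (0 : E) ‖x‖, y ∈ Metric.ball (0 : E) ε := fun y hy => by
    rw [mem_closedBall_zero_iff] at hy
    rw [mem_ball_zero_iff] at hx ⊢
    linarith
  have h2 := (convex_closedBall (0 : E) ‖x‖).norm_image_sub_le_of_norm_hasFDerivWithin_le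
    (f := fun y => f y - fderiv ℝ f 0 y) (f' := fun y => fderiv ℝ f y - fderiv ℝ f 0)
    (C := K * ‖x‖) (x := 0) (y := x)
    (fun y hy => ((hball y (hsub y hy)).1.hasFDerivAt.sub
      (fderiv ℝ f 0).hasFDerivAt).hasFDerivWithinAt)
    (fun y hy => by
      have h3 := hK.dist_le_mul y (hball y (hsub y hy)).2 0 h0
      rw [dist_eq_norm, dist_zero_right] at h3
      rw [mem_closedBall_zero_iff] at hy
      exact h3.trans (by gcongr))
    (by simp) (by simp)
  simp only [map_zero, sub_zero] at h2
  calc _ = ‖f x - fderiv ℝ f 0 x - f 0‖ := by congr 1; abel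
    _ ≤ _ := h2
    _ = _ := by ring

/-- The limit of `r⁻ᵐ Fᵐ`. -/
noncomputable def linearizer (r : ℝ) (F : E → E) (x : E) : E :=
  limUnder atTop fun m : ℕ => (r⁻¹) ^ m • F^[m] x

/-- A germ at a fixed point `0` whose derivative there is the homothety of ratio `r < 1`. -/
structure IsHomotheticContraction (r : ℝ) (F : E → E) : Prop where
  pos : 0 < r
  lt_one : r < 1
  map_zero : F 0 = 0
  contDiffAt : ContDiffAt ℝ ∞ F 0
  hasFDerivAt : HasFDerivAt F (r • ContinuousLinearMap.id ℝ E) 0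

/-- The constants entering the convergence of `r⁻ᵐ Fᵐ` on the ball of radius `ρ`. -/
structure ContractionBound (r : ℝ) (F : E → E) (μ C ρ : ℝ) : Prop where
  pos : 0 < ρ
  mu_nonneg : 0 ≤ μ
  mu_lt_one : μ < 1
  mu_sq_lt : μ ^ 2 < r
  C_nonneg : 0 ≤ C
  norm_le : ∀ x ∈ Metric.ball (0 : E) ρ, ‖F x‖ ≤ μ * ‖x‖
  norm_sub_le : ∀ x ∈ Metric.ball (0 : E) ρ, ‖F x - r • x‖ ≤ C * ‖x‖ ^ 2
  differentiableAt : ∀ x ∈ Metric.ball (0 : E) ρ, DifferentiableAt ℝ F x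

theorem IsHomotheticContraction.exists_bound {r : ℝ} {F : E → E}
    (h : IsHomotheticContraction r F) : ∃ μ C ρ, ContractionBound r F μ C ρ := by
  have h2 : ContDiffAt ℝ 2 F 0 := h.contDiffAt.of_le (by norm_cast)
  obtain ⟨C, hC, hC'⟩ := h2.exists_norm_sub_le_sq
  have hr := h.pos
  have hs : r < √r := Real.lt_sqrt_of_sq_lt (by nlinarith [h.lt_one])
  have hs1 : √r < 1 := by rw [Real.sqrt_lt' one_pos]; simpa using h.lt_one
  have hd : ∀ᶠ x in 𝓝 (0 : E), DifferentiableAt ℝ F x :=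
    (h2.eventually (by simp)).mono fun x hx => hx.differentiableAt (by simp)
  obtain ⟨ε, hε, hball⟩ := Metric.eventually_nhds_iff_ball.mp (hC'.and hd)
  obtain ⟨δ, hδ, hδ'⟩ : ∃ δ > 0, C * δ ≤ (√r - r) / 2 := by
    refine ⟨(√r - r) / 2 / (C + 1), by have := sub_pos.mpr hs; positivity, ?_⟩
    rw [← mul_div_assoc, div_le_iff₀ (by linarith)]
    nlinarith
  have hsub : ∀ x ∈ Metric.ball (0 : E) (min ε δ), ‖F x - r • x‖ ≤ C * ‖x‖ ^ 2 := fun x hx => by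
    have h1 := (hball x (Metric.ball_subset_ball (min_le_left _ _) hx)).1
    rw [h.map_zero, h.hasFDerivAt.fderiv] at h1
    simpa using h1
  -- μ is the midpoint of r and √r: larger than r, so that it bounds F near 0, and with μ² < r, so
  -- that quadratic errors along an orbit beat the growth of r⁻ᵐ.
  refine ⟨(r + √r) / 2, C, min ε δ, lt_min hε hδ, by linarith, by linarith, ?_, hC, fun x hx => ?_,
    hsub, fun x hx => (hball x (Metric.ball_subset_ball (min_le_left _ _) hx)).2⟩
  · nlinarith [Real.sq_sqrt hr.le]
  · have h1 := hsub x hx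
    have h3 : ‖F x‖ ≤ ‖F x - r • x‖ + ‖r • x‖ := by
      simpa using norm_add_le (F x - r • x) (r • x)
    rw [norm_smul, Real.norm_of_nonneg hr.le] at h3
    have h4 : ‖x‖ ≤ δ := by
      rw [mem_ball_zero_iff] at hx
      exact hx.le.trans (min_le_right _ _)
    have h5 : C * ‖x‖ ^ 2 ≤ (√r - r) / 2 * ‖x‖ := by
      calc C * ‖x‖ ^ 2 = (C * ‖x‖) * ‖x‖ := by ring
        _ ≤ (C * δ) * ‖x‖ := by gcongr
        _ ≤ _ := by gcongr
    linarith

namespace ContractionBound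

variable {r μ C ρ : ℝ} {F : E → E}

theorem mono (h : ContractionBound r F μ C ρ) {ρ' : ℝ} (h0 : 0 < ρ') (hle : ρ' ≤ ρ) :
    ContractionBound r F μ C ρ' :=
  ⟨h0, h.mu_nonneg, h.mu_lt_one, h.mu_sq_lt, h.C_nonneg,
    fun x hx => h.norm_le x (Metric.ball_subset_ball hle hx),
    fun x hx => h.norm_sub_le x (Metric.ball_subset_ball hle hx),
    fun x hx => h.differentiableAt x (Metric.ball_subset_ball hle hx)⟩

theorem r_pos (h : ContractionBound r F μ C ρ) : 0 < r :=
  (sq_nonneg μ).trans_lt h.mu_sq_lt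

theorem map_mem (h : ContractionBound r F μ C ρ) {x : E} (hx : x ∈ Metric.ball (0 : E) ρ) :
    F x ∈ Metric.ball (0 : E) ρ := by
  have h1 := h.norm_le x hx
  rw [mem_ball_zero_iff] at hx ⊢
  nlinarith [h.mu_lt_one, norm_nonneg x]

theorem iterate_mem (h : ContractionBound r F μ C ρ) {x : E} (hx : x ∈ Metric.ball (0 : E) ρ)
    (m : ℕ) : F^[m] x ∈ Metric.ball (0 : E) ρ := by
  induction m with
  | zero => exact hx
  | succ m ih =>
    rw [Function.iterate_succ_apply']
    exact h.map_mem ih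

theorem norm_iterate_le (h : ContractionBound r F μ C ρ) {x : E}
    (hx : x ∈ Metric.ball (0 : E) ρ) (m : ℕ) : ‖F^[m] x‖ ≤ μ ^ m * ‖x‖ := by
  induction m with
  | zero => simp
  | succ m ih =>
    rw [Function.iterate_succ_apply', pow_succ', mul_assoc]
    exact (h.norm_le _ (h.iterate_mem hx m)).trans (mul_le_mul_of_nonneg_left ih h.mu_nonneg)

theorem tendsto_iterate (h : ContractionBound r F μ C ρ) {x : E}
    (hx : x ∈ Metric.ball (0 : E) ρ) : Tendsto (fun m => F^[m] x) atTop (𝓝 0) := by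
  refine squeeze_zero_norm (h.norm_iterate_le hx) ?_
  simpa using (tendsto_pow_atTop_nhds_zero_of_lt_one h.mu_nonneg h.mu_lt_one).mul_const ‖x‖

/-- One step changes the rescaled iterate by r⁻ᵐ⁻¹ times the quadratic error at Fᵐ(x), which is at
most C(μᵐ‖x‖)²; the ratio μ²/r is below 1. -/
theorem dist_le (h : ContractionBound r F μ C ρ) {x : E} (hx : x ∈ Metric.ball (0 : E) ρ) (m : ℕ) :
    dist ((r⁻¹) ^ m • F^[m] x) ((r⁻¹) ^ (m + 1) • F^[m + 1] x) ≤
      (r⁻¹ * C * ‖x‖ ^ 2) * (μ ^ 2 / r) ^ m := by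
  have hr := h.r_pos
  have h1 : (r⁻¹) ^ (m + 1) • F^[m + 1] x - (r⁻¹) ^ m • F^[m] x =
      (r⁻¹) ^ (m + 1) • (F (F^[m] x) - r • F^[m] x) := by
    rw [Function.iterate_succ_apply', smul_sub, smul_smul, pow_succ, mul_assoc,
      inv_mul_cancel₀ hr.ne', mul_one]
  rw [dist_comm, dist_eq_norm, h1, norm_smul, norm_pow, norm_inv, Real.norm_of_nonneg hr.le]
  calc (r⁻¹) ^ (m + 1) * ‖F (F^[m] x) - r • F^[m] x‖
      ≤ (r⁻¹) ^ (m + 1) * (C * (μ ^ m * ‖x‖) ^ 2) := by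
        gcongr
        refine (h.norm_sub_le _ (h.iterate_mem hx m)).trans ?_
        have := h.norm_iterate_le hx m
        have := h.C_nonneg
        gcongr
    _ = _ := by
      rw [div_pow, inv_pow, pow_succ, mul_pow, ← pow_mul, ← pow_mul, mul_comm m 2]
      field_simp

theorem ratio_lt_one (h : ContractionBound r F μ C ρ) : μ ^ 2 / r < 1 :=
  (div_lt_one h.r_pos).mpr h.mu_sq_lt

theorem tendsto_linearizer [CompleteSpace E] (h : ContractionBound r F μ C ρ) {x : E}
    (hx : x ∈ Metric.ball (0 : E) ρ) :
    Tendsto (fun m : ℕ => (r⁻¹) ^ m • F^[m] x) atTop (𝓝 (linearizer r F x)) :=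
  (cauchySeq_of_le_geometric _ _ h.ratio_lt_one (h.dist_le hx)).tendsto_limUnder

theorem linearizer_map [CompleteSpace E] (h : ContractionBound r F μ C ρ) {x : E}
    (hx : x ∈ Metric.ball (0 : E) ρ) : linearizer r F (F x) = r • linearizer r F x := by
  refine tendsto_nhds_unique (h.tendsto_linearizer (h.map_mem hx)) ?_
  refine (((tendsto_add_atTop_iff_nat 1).mpr (h.tendsto_linearizer hx)).const_smul r).congr
    fun m => ?_
  rw [smul_smul, pow_succ', mul_inv_cancel_left₀ h.r_pos.ne', Function.iterate_succ_apply]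

theorem linearizer_iterate [CompleteSpace E] (h : ContractionBound r F μ C ρ) {x : E}
    (hx : x ∈ Metric.ball (0 : E) ρ) (m : ℕ) :
    linearizer r F x = (r⁻¹) ^ m • linearizer r F (F^[m] x) := by
  induction m with
  | zero => simp
  | succ m ih =>
    rw [ih, Function.iterate_succ_apply', h.linearizer_map (h.iterate_mem hx m), smul_smul,
      pow_succ, mul_assoc, inv_mul_cancel₀ h.r_pos.ne', mul_one]

theorem dist_linearizer_le [CompleteSpace E] (h : ContractionBound r F μ C ρ) {x : E}
    (hx : x ∈ Metric.ball (0 : E) ρ) (m : ℕ) :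
    dist ((r⁻¹) ^ m • F^[m] x) (linearizer r F x) ≤
      (r⁻¹ * C * ‖x‖ ^ 2) * (μ ^ 2 / r) ^ m / (1 - μ ^ 2 / r) :=
  dist_le_of_le_geometric_of_tendsto _ _ h.ratio_lt_one (h.dist_le hx) (h.tendsto_linearizer hx) m

theorem norm_linearizer_sub_le [CompleteSpace E] (h : ContractionBound r F μ C ρ) {x : E}
    (hx : x ∈ Metric.ball (0 : E) ρ) :
    ‖linearizer r F x - x‖ ≤ (r⁻¹ * C / (1 - μ ^ 2 / r)) * ‖x‖ ^ 2 := by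
  have h1 := h.dist_linearizer_le hx 0
  simp only [pow_zero, one_smul, Function.iterate_zero, id, mul_one] at h1
  rw [dist_comm, dist_eq_norm] at h1
  exact h1.trans_eq (by ring)

theorem hasFDerivAt_linearizer_zero [CompleteSpace E] (h : ContractionBound r F μ C ρ) :
    linearizer r F 0 = 0 ∧
      HasFDerivAt (linearizer r F) (ContinuousLinearMap.id ℝ E) 0 := by
  have hl0 : linearizer r F 0 = 0 := by
    simpa using h.norm_linearizer_sub_le (Metric.mem_ball_self h.pos)
  refine ⟨hl0, HasFDerivAt.of_isLittleO ?_⟩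
  have h1 : (fun x => linearizer r F x - linearizer r F 0 - ContinuousLinearMap.id ℝ E (x - 0))
      =O[𝓝 0] fun x : E => ‖x - 0‖ ^ 2 := by
    refine Asymptotics.IsBigO.of_bound (r⁻¹ * C / (1 - μ ^ 2 / r)) ?_
    filter_upwards [Metric.ball_mem_nhds _ h.pos] with x hx
    simpa [hl0] using h.norm_linearizer_sub_le hx
  exact h1.trans_isLittleO (by
    simpa only [sub_zero] using Asymptotics.isLittleO_norm_pow_id one_lt_two)

theorem tendstoUniformlyOn [CompleteSpace E] (h : ContractionBound r F μ C ρ) :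
    TendstoUniformlyOn (fun (m : ℕ) x => (r⁻¹) ^ m • F^[m] x) (linearizer r F) atTop
      (Metric.ball 0 ρ) := by
  have hr := h.r_pos
  have h1 : Tendsto (fun m : ℕ => (r⁻¹ * C * ρ ^ 2) * (μ ^ 2 / r) ^ m / (1 - μ ^ 2 / r))
      atTop (𝓝 0) := by
    simpa using ((tendsto_pow_atTop_nhds_zero_of_lt_one (by positivity)
      h.ratio_lt_one).const_mul (r⁻¹ * C * ρ ^ 2)).div_const (1 - μ ^ 2 / r)
  rw [Metric.tendstoUniformlyOn_iff]
  intro ε hε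
  filter_upwards [h1.eventually (gt_mem_nhds hε)] with m hm x hx
  rw [dist_comm]
  refine (h.dist_linearizer_le hx m).trans_lt (lt_of_le_of_lt ?_ hm)
  have h2 := h.ratio_lt_one
  have h3 := h.C_nonneg
  rw [mem_ball_zero_iff] at hx
  have : 0 < 1 - μ ^ 2 / r := by linarith
  gcongr

theorem hasFDerivAt_iterate (h : ContractionBound r F μ C ρ) {x : E}
    (hx : x ∈ Metric.ball (0 : E) ρ) (m : ℕ) :
    HasFDerivAt F^[m] (fderiv ℝ F^[m] x) x := by
  refine DifferentiableAt.hasFDerivAt ?_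
  induction m with
  | zero => exact differentiableAt_id
  | succ m ih =>
    rw [Function.iterate_succ']
    exact (h.differentiableAt _ (h.iterate_mem hx m)).comp x ih

end ContractionBound

end Linearization

/-! ### Smoothness of the linearizer through tangent maps. -/

section LinearizationSmooth

universe u

variable {E : Type u} [NormedAddCommGroup E] [NormedSpace ℝ E]

/-- The tangent map of `F`. -/
noncomputable def tangentOf (F : E → E) (p : E × E) : E × E := (F p.1, fderiv ℝ F p.1 p.2)

/-- The second derivative of `F` does not contribute to the differential at the origin, since there
it is applied to the zero vector. The class is therefore stable under tangent maps, which permits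
induction on regularity. -/
theorem IsHomotheticContraction.tangentOf {r : ℝ} {F : E → E} (h : IsHomotheticContraction r F) :
    IsHomotheticContraction r (tangentOf F) where
  pos := h.pos
  lt_one := h.lt_one
  map_zero := by simp [_root_.tangentOf, h.map_zero]
  contDiffAt := by
    have h1 : ContDiffAt ℝ ∞ (fderiv ℝ F) (0 : E × E).1 := h.contDiffAt.fderiv_right (by simp)
    have h2 : ContDiffAt ℝ ∞ F (0 : E × E).1 := h.contDiffAt
    exact (h2.comp _ contDiffAt_fst).prodMk ((h1.comp _ contDiffAt_fst).clm_apply contDiffAt_snd)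
  hasFDerivAt := by
    have h1 : ContDiffAt ℝ 1 (fderiv ℝ F) (0 : E × E).1 :=
      h.contDiffAt.fderiv_right (by norm_cast)
    have h2 := (h1.differentiableAt (by simp)).hasFDerivAt
    have h3 : HasFDerivAt F (r • ContinuousLinearMap.id ℝ E) (0 : E × E).1 := h.hasFDerivAt
    have h4 := (h3.comp (0 : E × E) hasFDerivAt_fst).prodMk
      ((h2.comp (0 : E × E) hasFDerivAt_fst).clm_apply hasFDerivAt_snd)
    refine h4.congr_fderiv ?_
    ext p <;> simp [h.hasFDerivAt.fderiv]

theorem ContractionBound.tangentOf_iterate {r μ C ρ : ℝ} {F : E → E}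
    (h : ContractionBound r F μ C ρ) {x : E} (hx : x ∈ Metric.ball (0 : E) ρ) (y : E) (m : ℕ) :
    (tangentOf F)^[m] (x, y) = (F^[m] x, fderiv ℝ F^[m] x y) := by
  induction m with
  | zero => simp
  | succ m ih =>
    rw [Function.iterate_succ_apply', ih, tangentOf, Function.iterate_succ_apply']
    simp only [Prod.mk.injEq, true_and]
    have h1 : HasFDerivAt F^[m + 1] ((fderiv ℝ F (F^[m] x)).comp (fderiv ℝ F^[m] x)) x := by
      rw [Function.iterate_succ']
      exact (h.differentiableAt _ (h.iterate_mem hx m)).hasFDerivAt.comp x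
        (h.hasFDerivAt_iterate hx m)
    rw [h1.fderiv]
    rfl

/-- The differential of the linearizer. -/
theorem ContractionBound.exists_hasFDerivAt_linearizer [CompleteSpace E]
    {r μ C ρ μ' C' : ℝ} {F : E → E}
    (h : ContractionBound r F μ C ρ) (h' : ContractionBound r (tangentOf F) μ' C' ρ) :
    ∃ g : E → E →L[ℝ] E, (∀ x ∈ Metric.ball (0 : E) ρ, HasFDerivAt (linearizer r F) (g x) x) ∧
      ∀ x ∈ Metric.ball (0 : E) ρ, ∀ y ∈ Metric.ball (0 : E) ρ,
        g x y = (linearizer r (tangentOf F) (x, y)).2 := by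
  obtain ⟨G, hG⟩ : ∃ G : ℕ → E → E →L[ℝ] E, ∀ m x, G m x = (r⁻¹) ^ m • fderiv ℝ F^[m] x :=
    ⟨_, fun _ _ => rfl⟩
  have hpt : ∀ x ∈ Metric.ball (0 : E) ρ, ∀ y ∈ Metric.ball (0 : E) ρ, (x, y) ∈
      Metric.ball (0 : E × E) ρ := fun x hx y hy => by
    rw [mem_ball_zero_iff] at *
    rw [Prod.norm_def]
    exact max_lt hx hy
  have hGT : ∀ x ∈ Metric.ball (0 : E) ρ, ∀ y m,
      G m x y = ((r⁻¹) ^ m • (tangentOf F)^[m] (x, y)).2 := fun x hx y m => by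
    rw [h.tangentOf_iterate hx, hG]
    rfl
  -- The second components of the rescaled iterates of the tangent map are `G m x y`, so they are
  -- uniformly Cauchy for `y` in the ball. Testing on vectors of norm `ρ / 2` gives the operator
  -- norm.
  have hcau : UniformCauchySeqOn G atTop (Metric.ball (0 : E) ρ) := by
    have h1 := h'.tendstoUniformlyOn.uniformCauchySeqOn
    rw [Metric.uniformCauchySeqOn_iff] at h1 ⊢
    intro ε hε
    have hρ := h.pos
    obtain ⟨N, hN⟩ := h1 (ε * ρ / 4) (by positivity)
    refine ⟨N, fun m hm n hn x hx => ?_⟩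
    rw [dist_eq_norm]
    refine lt_of_le_of_lt (b := ε / 2) ?_ (by linarith)
    refine ContinuousLinearMap.opNorm_le_of_unit_norm (by positivity) fun y hy => ?_
    have hmem : (ρ / 2) • y ∈ Metric.ball (0 : E) ρ := by
      rw [mem_ball_zero_iff, norm_smul, hy, Real.norm_of_nonneg (by positivity)]
      linarith
    have h2 := hN m hm n hn (x, (ρ / 2) • y) (hpt x hx _ hmem)
    have h3 : ‖(G m x - G n x) ((ρ / 2) • y)‖ < ε * ρ / 4 := by
      rw [sub_apply, hGT x hx, hGT x hx, ← Prod.snd_sub]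
      rw [dist_eq_norm] at h2
      exact (norm_snd_le _).trans_lt h2
    rw [map_smul, norm_smul, Real.norm_of_nonneg (by positivity)] at h3
    have h4 : ρ / 2 * ‖(G m x - G n x) y‖ < ρ / 2 * (ε / 2) := by linarith
    exact (lt_of_mul_lt_mul_left h4 (by positivity)).le
  have hlim : ∀ x, ∃ g : E →L[ℝ] E, x ∈ Metric.ball (0 : E) ρ →
      Tendsto (fun m => G m x) atTop (𝓝 g) := fun x => by
    by_cases hx : x ∈ Metric.ball (0 : E) ρ
    · obtain ⟨g, hg⟩ := cauchySeq_tendsto_of_complete (hcau.cauchySeq hx)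
      exact ⟨g, fun _ => hg⟩
    · exact ⟨0, fun hx' => absurd hx' hx⟩
  choose g hg using hlim
  have hunif : TendstoUniformlyOn G g atTop (Metric.ball (0 : E) ρ) :=
    hcau.tendstoUniformlyOn_of_tendsto fun x hx => hg x hx
  refine ⟨g, fun x hx => ?_, fun x hx y hy => ?_⟩
  · refine hasFDerivAt_of_tendstoUniformlyOn Metric.isOpen_ball hunif (fun m x hx => ?_)
      (fun x hx => h.tendsto_linearizer hx) hx
    rw [hG]
    exact (h.hasFDerivAt_iterate hx m).const_smul _
  · have h1 : Tendsto (fun m => G m x y) atTop (𝓝 (g x y)) :=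
      ((ContinuousLinearMap.apply ℝ E y).continuous.tendsto _).comp (hg x hx)
    have h2 := (continuous_snd.tendsto _).comp (h'.tendsto_linearizer (hpt x hx y hy))
    refine tendsto_nhds_unique h1 (h2.congr fun m => ?_)
    rw [hGT x hx]
    rfl

/-- The differential of the linearizer of `F` is read off from the linearizer of the tangent map, so
class Cʲ for the latter gives class Cʲ⁺¹ for the former. The space is quantified inside the
induction because the step passes from `E` to `E × E`. -/
theorem contDiffAt_linearizer_nat (j : ℕ) : ∀ (E : Type u) [NormedAddCommGroup E] [NormedSpace ℝ E]
    [FiniteDimensional ℝ E] {r : ℝ} {F : E → E}, IsHomotheticContraction r F →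
    ContDiffAt ℝ j (linearizer r F) 0 := by
  induction j with
  | zero =>
    intro E _ _ _ r F hF
    have := FiniteDimensional.complete ℝ E
    obtain ⟨μ, C, ρ, h⟩ := hF.exists_bound
    refine contDiffAt_zero.mpr ⟨Metric.ball 0 ρ, Metric.ball_mem_nhds _ h.pos, ?_⟩
    refine h.tendstoUniformlyOn.continuousOn (Frequently.of_forall fun m x hx => ?_)
    exact ((h.hasFDerivAt_iterate hx m).continuousAt.const_smul _).continuousWithinAt
  | succ j ih =>
    intro E _ _ _ r F hF
    have := FiniteDimensional.complete ℝ E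
    obtain ⟨μ, C, ρ, h⟩ := hF.exists_bound
    obtain ⟨μ', C', ρ', h'⟩ := hF.tangentOf.exists_bound
    have hmin := lt_min h.pos h'.pos
    obtain ⟨g, hg, hgT⟩ := (h.mono hmin (min_le_left _ _)).exists_hasFDerivAt_linearizer
      (h'.mono hmin (min_le_right _ _))
    obtain ⟨u, hu, hcd⟩ := ((ih (E × E) hF.tangentOf).contDiffOn le_rfl (by simp))
    obtain ⟨ε, hε, hεu⟩ := Metric.mem_nhds_iff.mp hu
    have hR := lt_min hmin hε
    push_cast
    refine contDiffAt_succ_iff_hasFDerivAt.mpr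
      ⟨g, ⟨_, Metric.ball_mem_nhds 0 hmin, hg⟩, ?_⟩
    refine ContDiffOn.contDiffAt (s := Metric.ball 0 (min (min ρ ρ') ε)) ?_
      (Metric.ball_mem_nhds 0 hR)
    refine contDiffOn_clm_apply.mpr fun y => ?_
    -- The formula for `g x y` holds only for `y` in the ball; other vectors are reached by
    -- rescaling.
    obtain ⟨s, hs0, hs⟩ : ∃ s : ℝ, s ≠ 0 ∧ s • y ∈ Metric.ball (0 : E) (min (min ρ ρ') ε) := by
      refine ⟨min (min ρ ρ') ε / (‖y‖ + 1), by positivity, ?_⟩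
      rw [mem_ball_zero_iff, norm_smul, Real.norm_of_nonneg (by positivity), div_mul_eq_mul_div,
        div_lt_iff₀ (by positivity)]
      nlinarith
    have h1 : ContDiffOn ℝ j (fun x : E => linearizer r (tangentOf F) (x, s • y))
        (Metric.ball 0 (min (min ρ ρ') ε)) := by
      refine hcd.comp (contDiff_id.prodMk contDiff_const).contDiffOn fun x hx => hεu ?_
      have hx' := Metric.ball_subset_ball (min_le_right _ _) hx
      have hs' := Metric.ball_subset_ball (min_le_right _ _) hs
      rw [mem_ball_zero_iff] at hx' hs' ⊢
      exact max_lt hx' hs'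
    refine (h1.snd.const_smul s⁻¹).congr fun x hx => ?_
    rw [← hgT x (Metric.ball_subset_ball (min_le_left _ _) hx) _
      (Metric.ball_subset_ball (min_le_left _ _) hs), map_smul, inv_smul_smul₀ hs0]

variable [FiniteDimensional ℝ E]

/-- The neighbourhood on which Cʲ regularity is known may shrink with `j`. On one fixed ball the
linearizer equals r⁻ᵐ times itself composed with Fᵐ, and Fᵐ brings any point into that
neighbourhood. -/
theorem eventually_contDiffAt_linearizer {r : ℝ} {F : E → E} (hF : IsHomotheticContraction r F)
    (hs : ∀ᶠ x in 𝓝 0, ContDiffAt ℝ ∞ F x) : ∀ᶠ x in 𝓝 0, ContDiffAt ℝ ∞ (linearizer r F) x := by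
  have := FiniteDimensional.complete ℝ E
  obtain ⟨μ, C, ρ, h⟩ := hF.exists_bound
  obtain ⟨ε, hε, hsε⟩ := Metric.eventually_nhds_iff_ball.mp hs
  have h' := h.mono (lt_min h.pos hε) (min_le_left _ _)
  filter_upwards [Metric.ball_mem_nhds (0 : E) h'.pos] with x hx
  refine contDiffAt_infty.mpr fun j => ?_
  have hj : ∀ᶠ y in 𝓝 (0 : E), ContDiffAt ℝ j (linearizer r F) y :=
    (contDiffAt_linearizer_nat j E hF).eventually (by simp)
  obtain ⟨m, hm⟩ := ((h'.tendsto_iterate hx).eventually hj).exists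
  have hiter : ∀ m, ContDiffAt ℝ ∞ F^[m] x := fun m => by
    induction m with
    | zero => exact contDiffAt_id
    | succ m ih =>
      rw [Function.iterate_succ']
      exact (hsε _ (Metric.ball_subset_ball (min_le_right _ _) (h'.iterate_mem hx m))).comp x ih
  have h1 : ContDiffAt ℝ j (fun y => (r⁻¹) ^ m • linearizer r F (F^[m] y)) x :=
    (hm.comp x ((hiter m).of_le (by exact_mod_cast le_top))).const_smul _
  refine h1.congr_of_eventuallyEq ?_
  filter_upwards [Metric.isOpen_ball.mem_nhds hx] with y hy
  exact h'.linearizer_iterate hy m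

/-- A smooth map near `0` whose derivative at `0` is invertible, as a local diffeomorphism. -/
theorem exists_localDiffeo {f : E → E} (L : E ≃L[ℝ] E) (h0 : f 0 = 0)
    (hs : ∀ᶠ x in 𝓝 0, ContDiffAt ℝ ∞ f x) (hf : HasFDerivAt f (L : E →L[ℝ] E) 0) :
    ∃ H : LocalDiffeo E, H.toFun = f := by
  have := FiniteDimensional.complete ℝ E
  have hs0 := hs.self_of_nhds
  let e := hs0.toOpenPartialHomeomorph f hf (by simp)
  have hef : (e : E → E) = f := rfl
  have hmem : (0 : E) ∈ e.source := hs0.mem_toOpenPartialHomeomorph_source hf (by simp)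
  have hmem' : (0 : E) ∈ e.target := by
    have := e.map_source hmem
    rwa [hef, h0] at this
  have he0 : e.symm 0 = 0 := by
    have := e.left_inv hmem
    rwa [hef, h0] at this
  have hinv : ∀ᶠ x in 𝓝 (0 : E), ∃ L' : E ≃L[ℝ] E, (L' : E →L[ℝ] E) = fderiv ℝ f x := by
    have h1 : ContinuousAt (fderiv ℝ f) 0 := (hs0.fderiv_right (m := 0) (by simp)).continuousAt
    have h2 : Set.range ((↑) : (E ≃L[ℝ] E) → E →L[ℝ] E) ∈ 𝓝 (fderiv ℝ f 0) := by
      rw [hf.fderiv]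
      exact L.nhds
    exact h1.eventually h2
  have hcont : Tendsto e.symm (𝓝 0) (𝓝 0) := by
    have := (e.continuousAt_symm hmem').tendsto
    rwa [he0] at this
  refine ⟨⟨f, e.symm, h0, hs, ?_, ?_, ?_⟩, rfl⟩
  · filter_upwards [e.open_target.mem_nhds hmem', hcont.eventually hinv, hcont.eventually hs]
      with x hx hL hsx
    obtain ⟨L', hL'⟩ := hL
    refine e.contDiffAt_symm (f₀' := L') hx ?_ hsx
    rw [hL']
    exact (hsx.differentiableAt (by simp)).hasFDerivAt
  · filter_upwards [e.open_source.mem_nhds hmem] with x hx using e.left_inv hx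
  · filter_upwards [e.open_target.mem_nhds hmem'] with x hx using e.right_inv hx

/-- Smooth linearization of a contraction with homothetic derivative. -/
theorem IsHomotheticContraction.exists_linearization {r : ℝ} {F : E → E}
    (hF : IsHomotheticContraction r F) (hs : ∀ᶠ x in 𝓝 0, ContDiffAt ℝ ∞ F x) :
    ∃ H : LocalDiffeo E, HasFDerivAt H.toFun (ContinuousLinearMap.id ℝ E) 0 ∧
      ∀ᶠ x in 𝓝 0, H.toFun (F x) = r • H.toFun x := by
  have := FiniteDimensional.complete ℝ E
  obtain ⟨μ, C, ρ, h⟩ := hF.exists_bound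
  obtain ⟨h0, h1⟩ := h.hasFDerivAt_linearizer_zero
  obtain ⟨H, hH⟩ := exists_localDiffeo (ContinuousLinearEquiv.refl ℝ E) h0
    (eventually_contDiffAt_linearizer hF hs) h1
  refine ⟨H, hH ▸ h1, ?_⟩
  rw [hH]
  filter_upwards [Metric.ball_mem_nhds (0 : E) h.pos] with x hx using h.linearizer_map hx

end LinearizationSmooth

/-! ### Second order parts and uniqueness for the functional equation. -/

section QuadraticParts

open Asymptotics

variable {E : Type*} [NormedAddCommGroup E] [NormedSpace ℝ E]

/-- `G x = x + Q x x + o(‖x‖²)` at the origin. -/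
structure HasQuadraticPart (G : E → E) (Q : E →L[ℝ] E →L[ℝ] E) : Prop where
  map_zero : G 0 = 0
  isLittleO : (fun x => G x - x - Q x x) =o[𝓝 0] fun x => ‖x‖ ^ 2

theorem isBigO_diag (Q : E →L[ℝ] E →L[ℝ] E) : (fun x => Q x x) =O[𝓝 0] fun x => ‖x‖ ^ 2 :=
  IsBigO.of_bound ‖Q‖ <| Eventually.of_forall fun x => by
    simpa [pow_two, mul_assoc] using Q.le_opNorm₂ x x

theorem isBigO_bilin_norm {α : Type*} {l : Filter α} (Q : E →L[ℝ] E →L[ℝ] E) (f g : α → E) :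
    (fun x => Q (f x) (g x)) =O[l] fun x => ‖f x‖ * ‖g x‖ :=
  IsBigO.of_bound ‖Q‖ <| Eventually.of_forall fun x => by
    simpa [mul_assoc] using Q.le_opNorm₂ (f x) (g x)

theorem isBigO_bilin {α : Type*} {l : Filter α} (Q : E →L[ℝ] E →L[ℝ] E) {f g : α → E}
    {a b : α → ℝ} (hf : f =O[l] a) (hg : g =O[l] b) :
    (fun x => Q (f x) (g x)) =O[l] fun x => a x * b x :=
  (isBigO_bilin_norm Q f g).trans (hf.norm_left.mul hg.norm_left)

theorem isBigO_id_norm {E : Type*} [NormedAddCommGroup E] :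
    (fun x : E => x) =O[𝓝 0] fun x => ‖x‖ :=
  (isBigO_refl _ _).norm_right

namespace HasQuadraticPart

variable {G G' : E → E} {Q Q' : E →L[ℝ] E →L[ℝ] E}

theorem isBigO_sub (h : HasQuadraticPart G Q) : (fun x => G x - x) =O[𝓝 0] fun x => ‖x‖ ^ 2 := by
  simpa using h.isLittleO.isBigO.add (isBigO_diag Q)

theorem norm_sq_isBigO {E : Type*} [NormedAddCommGroup E] : (fun x : E => ‖x‖ ^ 2) =O[𝓝 0] fun x => ‖x‖ := by
  have : (fun x : E => ‖x‖ ^ 2) =o[𝓝 0] fun x => ‖x‖ :=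
    (isLittleO_norm_pow_id (E' := E) one_lt_two).norm_right
  exact this.isBigO

theorem isBigO (h : HasQuadraticPart G Q) : G =O[𝓝 0] fun x => ‖x‖ := by
  simpa using (h.isBigO_sub.trans norm_sq_isBigO).add isBigO_id_norm

theorem tendsto (h : HasQuadraticPart G Q) : Tendsto G (𝓝 0) (𝓝 0) :=
  h.isBigO.trans_tendsto (by simpa using (continuous_norm (E := E)).tendsto 0)

theorem comp (h : HasQuadraticPart G Q) (h' : HasQuadraticPart G' Q') :
    HasQuadraticPart (fun x => G (G' x)) (Q + Q') := by
  refine ⟨by rw [h'.map_zero, h.map_zero], ?_⟩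
  have h1 : (fun x => G (G' x) - G' x - Q (G' x) (G' x)) =o[𝓝 0] fun x => ‖x‖ ^ 2 :=
    (h.isLittleO.comp_tendsto h'.tendsto).trans_isBigO (h'.isBigO.norm_left.pow 2)
  have h2 : (fun x => Q (G' x - x) (G' x) + Q x (G' x - x)) =o[𝓝 0] fun x : E => ‖x‖ ^ 2 := by
    have h3 := (isBigO_bilin Q h'.isBigO_sub h'.isBigO).add
      ((isBigO_bilin Q isBigO_id_norm h'.isBigO_sub).congr_right
        (g₂ := fun x => ‖x‖ ^ 2 * ‖x‖) fun x => by ring)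
    refine h3.trans_isLittleO ?_
    simpa [← pow_succ] using isLittleO_norm_pow_norm_pow (E' := E) (by norm_num : 2 < 3)
  refine ((h1.add h2).add h'.isLittleO).congr_left fun x => ?_
  simp only [map_sub, add_apply, sub_apply]
  abel

theorem iterate (h : HasQuadraticPart G Q) (m : ℕ) : HasQuadraticPart G^[m] ((m : ℝ) • Q) := by
  induction m with
  | zero => exact ⟨rfl, by simp⟩
  | succ m ih =>
    have := h.comp ih
    rw [Function.iterate_succ']
    have e : ((m + 1 : ℕ) : ℝ) • Q = Q + (m : ℝ) • Q := by
      push_cast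
      module
    rw [e]
    exact this

end HasQuadraticPart

theorem eq_zero_of_homogeneous_isLittleO {q : E → E} (m : ℕ)
    (hq : ∀ (t : ℝ) x, q (t • x) = t ^ m • q x) (ho : q =o[𝓝 0] fun x => ‖x‖ ^ m) (x : E) :
    q x = 0 := by
  by_contra hne
  have hpos : 0 < ‖q x‖ := norm_pos_iff.mpr hne
  obtain ⟨ε, hε, hlt⟩ : ∃ ε > 0, ε * ‖x‖ ^ m < ‖q x‖ := by
    refine ⟨‖q x‖ / (‖x‖ ^ m + 1), by positivity, ?_⟩
    rw [div_mul_eq_mul_div, div_lt_iff₀ (by positivity)]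
    nlinarith
  have h1 : Tendsto (fun t : ℝ => t • x) (𝓝[>] 0) (𝓝 0) := by
    have : Continuous fun t : ℝ => t • x := by fun_prop
    simpa using (this.tendsto 0).mono_left nhdsWithin_le_nhds
  obtain ⟨t, ht0, ht⟩ := ((eventually_mem_nhdsWithin (a := (0 : ℝ)) (s := Set.Ioi 0)).and
    (h1.eventually (ho.def hε))).exists
  have ht0' : (0 : ℝ) < t ^ m := pow_pos ht0 m
  rw [hq, norm_smul, norm_pow, norm_pow, norm_norm, norm_smul, mul_pow,
    Real.norm_of_nonneg (le_of_lt ht0)] at ht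
  have h2 : t ^ m * ‖q x‖ ≤ t ^ m * (ε * ‖x‖ ^ m) := by linarith
  exact absurd (le_of_mul_le_mul_left h2 ht0') (not_le.mpr hlt)

/-- Strict differentiability gives F(Gx) - Fx = A(Gx - x) + o(‖x‖²), because Gx - x is already of
second order. Hence the second order terms of `F` play no role. -/
theorem HasQuadraticPart.semiconj {G G' F : E → E} {Q Q' : E →L[ℝ] E →L[ℝ] E} {A : E →L[ℝ] E}
    (h : HasQuadraticPart G Q) (h' : HasQuadraticPart G' Q') (hF0 : F 0 = 0)
    (hF : HasStrictFDerivAt F A 0) (hFG : ∀ᶠ x in 𝓝 0, F (G x) = G' (F x)) (x : E) :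
    A (Q x x) = Q' (A x) (A x) := by
  have hFt : Tendsto F (𝓝 0) (𝓝 0) := by simpa [hF0] using hF.continuousAt.tendsto
  have hFA : (fun x => F x - A x) =o[𝓝 0] fun x => ‖x‖ := by
    simpa [hF0] using hF.hasFDerivAt.isLittleO.norm_right
  have hA : (fun x => A x) =O[𝓝 0] fun x => ‖x‖ := (A.isBigO_id _).norm_right
  have hFO : F =O[𝓝 0] fun x => ‖x‖ := by simpa using hFA.isBigO.add hA
  have h1 : (fun x => F (G x) - F x - A (G x - x)) =o[𝓝 0] fun x => ‖x‖ ^ 2 := by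
    have h2 : Tendsto (fun x => (G x, x)) (𝓝 0) (𝓝 ((0 : E), (0 : E))) :=
      h.tendsto.prodMk_nhds tendsto_id
    exact (hF.isLittleO.comp_tendsto h2).trans_isBigO h.isBigO_sub
  have h2 : (fun x => A (G x - x - Q x x)) =o[𝓝 0] fun x => ‖x‖ ^ 2 :=
    (A.isBigO_comp _ _).trans_isLittleO h.isLittleO
  have h3 : (fun x => G' (F x) - F x - Q' (F x) (F x)) =o[𝓝 0] fun x => ‖x‖ ^ 2 :=
    (h'.isLittleO.comp_tendsto hFt).trans_isBigO (hFO.norm_left.pow 2)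
  have h4 : (fun x => Q' (F x - A x) (F x) + Q' (A x) (F x - A x)) =o[𝓝 0]
      fun x => ‖x‖ ^ 2 := by
    have e1 := (isBigO_bilin_norm (l := 𝓝 0) Q' (fun x => F x - A x) F).trans_isLittleO
      (hFA.norm_left.mul_isBigO hFO.norm_left)
    have e2 := (isBigO_bilin_norm (l := 𝓝 0) Q' A (fun x => F x - A x)).trans_isLittleO
      (hA.norm_left.mul_isLittleO hFA.norm_left)
    exact (e1.add e2).congr_right fun x => (pow_two _).symm
  have h5 : (fun x => A (Q x x) - Q' (A x) (A x)) =o[𝓝 0] fun x => ‖x‖ ^ 2 := by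
    refine ((h3.add h4).sub (h1.add h2)).congr' ?_ EventuallyEq.rfl
    filter_upwards [hFG] with y hy
    rw [hy]
    simp only [map_sub, sub_apply]
    abel
  refine sub_eq_zero.mp (eq_zero_of_homogeneous_isLittleO 2 (fun t y => ?_) h5 x)
  simp only [map_smul, smul_apply]
  module

/-- A bound M‖x‖³ on the difference, inserted in the functional equation, gains the factor k·k·k⁻³ =
1/k up to Lipschitz constants close to 1. Here it improves by 3/4 at each application, so the
difference is zero. Agreement to third order is essential: for second order differences the factor
would be about 1. -/
theorem eventuallyEq_of_functional_equation {G G' : E → E} {k : ℕ} (hk : 2 ≤ k)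
    (h0 : G 0 = 0) (h0' : G' 0 = 0)
    (hG : HasStrictFDerivAt G (ContinuousLinearMap.id ℝ E) 0)
    (hG' : HasStrictFDerivAt G' (ContinuousLinearMap.id ℝ E) 0)
    (hO : (fun x => G x - G' x) =O[𝓝 0] fun x => ‖x‖ ^ 3)
    (he : ∀ᶠ x in 𝓝 0, G x = (k : ℝ) • G^[k] ((k : ℝ)⁻¹ • x))
    (he' : ∀ᶠ x in 𝓝 0, G' x = (k : ℝ) • G'^[k] ((k : ℝ)⁻¹ • x)) : G =ᶠ[𝓝 0] G' := by
  have hk' : (2 : ℝ) ≤ k := by exact_mod_cast hk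
  -- `c` is the common Lipschitz constant near 0; the bound 3/2, divided by k ≥ 2, produces the
  -- ratio 3/4.
  obtain ⟨c, hc1, hc⟩ : ∃ c : ℝ, 1 < c ∧ c ^ (3 * k) ≤ 3 / 2 := by
    have h1 : Tendsto (fun c : ℝ => c ^ (3 * k)) (𝓝[>] 1) (𝓝 1) := by
      have : Continuous fun c : ℝ => c ^ (3 * k) := by fun_prop
      simpa using (this.tendsto 1).mono_left nhdsWithin_le_nhds
    exact ((eventually_mem_nhdsWithin (a := (1 : ℝ)) (s := Set.Ioi 1)).and
      (h1.eventually (ge_mem_nhds (by norm_num : (1 : ℝ) < 3 / 2)))).exists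
  have hlip : ∀ {g : E → E}, HasStrictFDerivAt g (ContinuousLinearMap.id ℝ E) 0 →
      ∀ᶠ p in 𝓝 ((0 : E), (0 : E)), ‖g p.1 - g p.2‖ ≤ c * ‖p.1 - p.2‖ := fun {g} hg => by
    filter_upwards [hg.isLittleO.def (sub_pos.mpr hc1)] with p hp
    calc ‖g p.1 - g p.2‖ ≤ ‖g p.1 - g p.2 - (p.1 - p.2)‖ + ‖p.1 - p.2‖ := by
          simpa using norm_add_le (g p.1 - g p.2 - (p.1 - p.2)) (p.1 - p.2)
      _ ≤ (c - 1) * ‖p.1 - p.2‖ + ‖p.1 - p.2‖ := by simpa using hp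
      _ = _ := by ring
  obtain ⟨K, hK0, hK⟩ := hO.exists_nonneg
  rw [IsBigOWith] at hK
  obtain ⟨ε₁, hε₁, hb₁⟩ := Metric.eventually_nhds_iff_ball.mp (hK.and (he.and he'))
  obtain ⟨ε₂, hε₂, hb₂⟩ := Metric.eventually_nhds_iff_ball.mp ((hlip hG).and (hlip hG'))
  have hρ := lt_min hε₁ hε₂
  obtain ⟨ρ, hρ'⟩ : ∃ ρ, ρ = min ε₁ ε₂ := ⟨_, rfl⟩
  rw [← hρ'] at hρ
  have hLip : ∀ x ∈ Metric.ball (0 : E) ρ, ∀ y ∈ Metric.ball (0 : E) ρ,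
      ‖G x - G y‖ ≤ c * ‖x - y‖ ∧ ‖G' x - G' y‖ ≤ c * ‖x - y‖ := fun x hx y hy => by
    refine hb₂ (x, y) ?_
    rw [← Prod.zero_eq_mk, mem_ball_zero_iff]
    rw [mem_ball_zero_iff] at hx hy
    exact (max_lt hx hy).trans_le (hρ'.trans_le (min_le_right _ _))
  have hbase : ∀ x ∈ Metric.ball (0 : E) ρ, ‖G x - G' x‖ ≤ K * ‖x‖ ^ 3 ∧
      G x = (k : ℝ) • G^[k] ((k : ℝ)⁻¹ • x) ∧ G' x = (k : ℝ) • G'^[k] ((k : ℝ)⁻¹ • x) :=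
    fun x hx => by
      have := hb₁ x (Metric.ball_subset_ball (hρ'.trans_le (min_le_left _ _)) hx)
      simpa using this
  have hc0 : 0 < c := one_pos.trans hc1
  have hck : c ^ k ≤ k := by
    refine le_trans ?_ ((hc.trans (by norm_num)).trans hk')
    exact pow_le_pow_right₀ hc1.le (by omega)
  -- The first `k` points of the orbit of x/k stay in the ball, since the growth is at most cᵏ ≤ k.
  have horb : ∀ {g : E → E}, g 0 = 0 → (∀ x ∈ Metric.ball (0 : E) ρ,
      ∀ y ∈ Metric.ball (0 : E) ρ, ‖g x - g y‖ ≤ c * ‖x - y‖) → ∀ x ∈ Metric.ball (0 : E) ρ,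
      ∀ j < k, ‖g^[j] ((k : ℝ)⁻¹ • x)‖ ≤ c ^ j * (‖x‖ / k) ∧
        g^[j] ((k : ℝ)⁻¹ • x) ∈ Metric.ball (0 : E) ρ := by
    intro g hg0 hg x hx j
    rw [mem_ball_zero_iff] at hx
    induction j with
    | zero =>
      intro _
      have h1 : ‖(k : ℝ)⁻¹ • x‖ = ‖x‖ / k := by
        rw [norm_smul, norm_inv, Real.norm_natCast, div_eq_inv_mul]
      simp only [Function.iterate_zero, id, pow_zero, one_mul, h1, le_refl, true_and,
        mem_ball_zero_iff]
      exact (div_le_self (norm_nonneg x) (by linarith)).trans_lt hx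
    | succ j ih =>
      intro hj
      obtain ⟨h1, h2⟩ := ih (by omega)
      have h3 := hg _ h2 0 (Metric.mem_ball_self hρ)
      rw [hg0, sub_zero, sub_zero] at h3
      have h4 : ‖g^[j + 1] ((k : ℝ)⁻¹ • x)‖ ≤ c ^ (j + 1) * (‖x‖ / k) := by
        rw [Function.iterate_succ_apply']
        refine h3.trans ?_
        rw [pow_succ', mul_assoc]
        gcongr
      refine ⟨h4, ?_⟩
      rw [mem_ball_zero_iff]
      refine h4.trans_lt (lt_of_le_of_lt ?_ hx)
      have h5 : c ^ (j + 1) ≤ k := (pow_le_pow_right₀ hc1.le hj.le).trans hck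
      calc c ^ (j + 1) * (‖x‖ / k) ≤ k * (‖x‖ / k) := by gcongr
        _ = ‖x‖ := by field_simp
  have hind : ∀ m : ℕ, ∀ x ∈ Metric.ball (0 : E) ρ,
      ‖G x - G' x‖ ≤ (3 / 4) ^ m * K * ‖x‖ ^ 3 := by
    intro m
    induction m with
    | zero => intro x hx; simpa using (hbase x hx).1
    | succ m ih =>
      intro x hx
      obtain ⟨M, hM⟩ : ∃ M, M = (3 / 4 : ℝ) ^ m * K := ⟨_, rfl⟩
      have hM0 : 0 ≤ M := by rw [hM]; positivity
      rw [← hM] at ih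
      -- Telescoping: each iteration expands the previous difference by at most `c` and adds the
      -- difference of the two maps at an orbit point, bounded by `ih`. Only orbit points of index
      -- below `k` need lie in the ball.
      have h1 : ∀ j ≤ k, ‖G^[j] ((k : ℝ)⁻¹ • x) - G'^[j] ((k : ℝ)⁻¹ • x)‖ ≤
          j * c ^ (3 * j) * M * (‖x‖ / k) ^ 3 := by
        intro j
        induction j with
        | zero => simp
        | succ j ihj =>
          intro hj
          have h2 := ihj (by omega)
          obtain ⟨-, h3⟩ := horb h0 (fun x hx y hy => (hLip x hx y hy).1) x hx j (by omega)
          obtain ⟨h4, h5⟩ := horb h0' (fun x hx y hy => (hLip x hx y hy).2) x hx j (by omega)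
          rw [Function.iterate_succ_apply', Function.iterate_succ_apply']
          calc _ ≤ ‖G (G^[j] ((k : ℝ)⁻¹ • x)) - G (G'^[j] ((k : ℝ)⁻¹ • x))‖
                + ‖G (G'^[j] ((k : ℝ)⁻¹ • x)) - G' (G'^[j] ((k : ℝ)⁻¹ • x))‖ :=
                norm_sub_le_norm_sub_add_norm_sub _ _ _
            _ ≤ c * (j * c ^ (3 * j) * M * (‖x‖ / k) ^ 3) + M * (c ^ j * (‖x‖ / k)) ^ 3 := by
                gcongr
                · exact (hLip _ h3 _ h5).1.trans (by gcongr)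
                · exact (ih _ h5).trans (by gcongr)
            _ = (c ^ (3 * j + 1) * j + c ^ (3 * j)) * M * (‖x‖ / k) ^ 3 := by ring
            _ ≤ (c ^ (3 * (j + 1)) * j + c ^ (3 * (j + 1))) * M * (‖x‖ / k) ^ 3 := by
                have e1 : c ^ (3 * j + 1) ≤ c ^ (3 * (j + 1)) :=
                  pow_le_pow_right₀ hc1.le (by omega)
                have e2 : c ^ (3 * j) ≤ c ^ (3 * (j + 1)) := pow_le_pow_right₀ hc1.le (by omega)
                gcongr
            _ = _ := by push_cast; ring
      obtain ⟨-, h2, h3⟩ := hbase x hx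
      rw [h2, h3, ← smul_sub, norm_smul, Real.norm_natCast]
      calc _ ≤ k * (k * c ^ (3 * k) * M * (‖x‖ / k) ^ 3) := by gcongr; exact h1 k le_rfl
        _ = c ^ (3 * k) / k * M * ‖x‖ ^ 3 := by field_simp
        _ ≤ (3 / 2) / 2 * M * ‖x‖ ^ 3 := by gcongr
        _ = _ := by rw [hM]; ring
  filter_upwards [Metric.ball_mem_nhds (0 : E) hρ] with x hx
  have h1 : Tendsto (fun m : ℕ => (3 / 4 : ℝ) ^ m * K * ‖x‖ ^ 3) atTop (𝓝 0) := by
    simpa using ((tendsto_pow_atTop_nhds_zero_of_lt_one (by norm_num : (0 : ℝ) ≤ 3 / 4)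
      (by norm_num)).mul_const K).mul_const (‖x‖ ^ 3)
  have h2 := ge_of_tendsto' h1 fun m => hind m x hx
  exact sub_eq_zero.mp (norm_le_zero_iff.mp h2)

end QuadraticParts

/-! ### Commuting germs have commuting quadratic parts. -/

section QuadraticExpansion

open Asymptotics

variable {E : Type*} [NormedAddCommGroup E] [NormedSpace ℝ E]

/-- `G x = x + Q x x + r x` where `r` has Lipschitz constant `O(s²)` on the ball of radius `s`. -/
structure HasQuadraticExpansion (G : E → E) (Q : E →L[ℝ] E →L[ℝ] E) : Prop where
  map_zero : G 0 = 0
  exists_bound : ∃ C ρ : ℝ, 0 ≤ C ∧ 0 < ρ ∧ ∀ s ≤ ρ, ∀ x ∈ Metric.closedBall (0 : E) s,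
    ∀ y ∈ Metric.closedBall (0 : E) s,
      ‖(G x - x - Q x x) - (G y - y - Q y y)‖ ≤ C * s ^ 2 * ‖x - y‖

theorem symm_secondDeriv {G : E → E} (hG : ContDiffAt ℝ 3 G 0) (x y : E) :
    fderiv ℝ (fderiv ℝ G) 0 x y = fderiv ℝ (fderiv ℝ G) 0 y x :=
  (hG.isSymmSndFDerivAt (by simp; norm_num)) x y

/-- The derivative of the remainder is the first order Taylor remainder of the derivative of `G`,
hence O(s²) on the ball of radius s; the mean value inequality concludes. -/
theorem HasQuadraticExpansion.of_contDiffAt {G : E → E} (hG : ContDiffAt ℝ 3 G 0) (h0 : G 0 = 0)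
    (hD : fderiv ℝ G 0 = ContinuousLinearMap.id ℝ E) {Q : E →L[ℝ] E →L[ℝ] E}
    (hQ : ∀ x y, (2 : ℝ) • Q x y = fderiv ℝ (fderiv ℝ G) 0 x y) : HasQuadraticExpansion G Q := by
  refine ⟨h0, ?_⟩
  obtain ⟨C, hC, hC'⟩ := (hG.fderiv_right (m := 2) (by norm_num)).exists_norm_sub_le_sq
  have hd : ∀ᶠ x in 𝓝 (0 : E), DifferentiableAt ℝ G x :=
    (hG.eventually (by simp)).mono fun x hx => hx.differentiableAt (by simp)
  obtain ⟨ε, hε, hball⟩ := Metric.eventually_nhds_iff_ball.mp (hC'.and hd)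
  have hsymm : ∀ x y, Q x y = Q y x := fun x y => by
    have h1 : (2 : ℝ) • Q x y = (2 : ℝ) • Q y x := by rw [hQ, hQ, symm_secondDeriv hG]
    exact smul_right_injective E (two_ne_zero' ℝ) h1
  refine ⟨C, ε / 2, hC, by positivity, fun s hs x hx y hy => ?_⟩
  have hsub : ∀ z ∈ Metric.closedBall (0 : E) s, z ∈ Metric.ball (0 : E) ε := fun z hz =>
    Metric.closedBall_subset_ball (hs.trans_lt (by linarith)) hz
  refine (convex_closedBall (0 : E) s).norm_image_sub_le_of_norm_hasFDerivWithin_le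
    (f := fun z => G z - z - Q z z)
    (f' := fun z => fderiv ℝ G z - ContinuousLinearMap.id ℝ E - (2 : ℝ) • Q z)
    (fun z hz => ?_) (fun z hz => ?_) hy hx
  · have h1 := (hball z (hsub z hz)).2.hasFDerivAt
    have h2 : HasFDerivAt (fun z => Q z z) ((2 : ℝ) • Q z) z := by
      refine (Q.hasFDerivAt.clm_apply (hasFDerivAt_id z)).congr_fderiv ?_
      ext w
      simp only [add_apply, ContinuousLinearMap.comp_apply, ContinuousLinearMap.flip_apply,
        smul_apply, ContinuousLinearMap.id_apply, id, hsymm w z]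
      module
    exact ((h1.sub (hasFDerivAt_id z)).sub h2).hasFDerivWithinAt
  · have h1 := (hball z (hsub z hz)).1
    have h2 : fderiv ℝ (fderiv ℝ G) 0 z = (2 : ℝ) • Q z := by
      ext w
      rw [smul_apply, hQ]
    rw [hD, h2] at h1
    refine h1.trans ?_
    rw [mem_closedBall_zero_iff] at hz
    gcongr

namespace HasQuadraticExpansion

variable {G G' : E → E} {Q Q' : E →L[ℝ] E →L[ℝ] E}

theorem isBigO_cube (h : HasQuadraticExpansion G Q) :
    (fun x => G x - x - Q x x) =O[𝓝 0] fun x => ‖x‖ ^ 3 := by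
  obtain ⟨C, ρ, hC, hρ, hb⟩ := h.exists_bound
  refine IsBigO.of_bound C ?_
  filter_upwards [Metric.closedBall_mem_nhds (0 : E) hρ] with x hx
  have h1 := hb ‖x‖ (mem_closedBall_zero_iff.mp hx) x (by simp) 0 (by simp)
  simp only [h.map_zero, _root_.map_zero, sub_zero] at h1
  rw [norm_pow, norm_norm, pow_succ, ← mul_assoc]
  exact h1

theorem hasQuadraticPart (h : HasQuadraticExpansion G Q) : HasQuadraticPart G Q :=
  ⟨h.map_zero, h.isBigO_cube.trans_isLittleO
    (isLittleO_norm_pow_norm_pow (E' := E) (by norm_num : 2 < 3))⟩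

/-- By the Lipschitz bound, replacing G'x by x in the remainder of `G` costs only O(‖x‖⁴). The
unidentified cubic terms thus enter through G x + G' x - x, symmetrically in both germs, and
disappear from the commutator. -/
theorem comp_isBigO (h : HasQuadraticExpansion G Q) (h' : HasQuadraticExpansion G' Q') :
    (fun x => G (G' x) - (G x + G' x - x + (Q x (Q' x x) + Q (Q' x x) x))) =O[𝓝 0]
      fun x => ‖x‖ ^ 4 := by
  have hp := h'.hasQuadraticPart
  have h1 : (fun x => (G (G' x) - G' x - Q (G' x) (G' x)) - (G x - x - Q x x)) =O[𝓝 0]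
      fun x => ‖x‖ ^ 4 := by
    obtain ⟨C, ρ, hC, hρ, hb⟩ := h.exists_bound
    obtain ⟨M, hM, hM'⟩ := hp.isBigO.exists_nonneg
    have ht : ∀ᶠ x in 𝓝 (0 : E), (M + 1) * ‖x‖ ≤ ρ := by
      have : Continuous fun x : E => (M + 1) * ‖x‖ := by fun_prop
      exact this.continuousAt.eventually (ge_mem_nhds (by simpa using hρ))
    have h2 : (fun x => (G (G' x) - G' x - Q (G' x) (G' x)) - (G x - x - Q x x)) =O[𝓝 0]
        fun x => ‖x‖ ^ 2 * ‖G' x - x‖ := by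
      refine IsBigO.of_bound (C * (M + 1) ^ 2) ?_
      filter_upwards [ht, hM'.bound] with x hx hx'
      rw [norm_norm] at hx'
      have h3 := hb _ hx (G' x) (by
        rw [mem_closedBall_zero_iff]
        nlinarith [norm_nonneg x]) x (by
        rw [mem_closedBall_zero_iff]
        nlinarith [norm_nonneg x])
      rw [norm_mul, norm_pow, norm_norm, norm_norm]
      exact h3.trans_eq (by ring)
    refine h2.trans ?_
    exact ((isBigO_refl (fun x : E => ‖x‖ ^ 2) (𝓝 0)).mul hp.isBigO_sub.norm_left).congr_right
      fun x => by ring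
  have e1 := isBigO_bilin Q hp.isBigO_sub hp.isBigO_sub
  have e2 := isBigO_bilin Q isBigO_id_norm h'.isBigO_cube
  have e3 := isBigO_bilin Q h'.isBigO_cube isBigO_id_norm
  have e1' := e1.congr_right (g₂ := fun x => ‖x‖ ^ 4) fun x => by ring
  have e2' := e2.congr_right (g₂ := fun x => ‖x‖ ^ 4) fun x => by ring
  have e3' := e3.congr_right (g₂ := fun x => ‖x‖ ^ 4) fun x => by ring
  refine (((h1.add e1').add e2').add e3').congr_left fun x => ?_
  simp only [map_sub, sub_apply]
  abel

/-- Commuting germs have commuting quadratic parts. -/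
theorem commute (h : HasQuadraticExpansion G Q) (h' : HasQuadraticExpansion G' Q')
    (hs : ∀ x y, Q x y = Q y x) (hs' : ∀ x y, Q' x y = Q' y x)
    (hc : ∀ᶠ x in 𝓝 0, G (G' x) = G' (G x)) (x : E) : Q x (Q' x x) = Q' x (Q x x) := by
  have h1 := (h'.comp_isBigO h).sub (h.comp_isBigO h')
  have h2 : (fun x => (2 : ℝ) • (Q x (Q' x x) - Q' x (Q x x))) =o[𝓝 0] fun x => ‖x‖ ^ 3 := by
    refine IsBigO.trans_isLittleO (h1.congr' ?_ EventuallyEq.rfl)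
      (isLittleO_norm_pow_norm_pow (E' := E) (by norm_num : 3 < 4))
    filter_upwards [hc] with y hy
    rw [hy, hs (Q' y y) y, hs' (Q y y) y]
    module
  have h3 := eq_zero_of_homogeneous_isLittleO 3 (fun t y => ?_) h2 x
  · exact sub_eq_zero.mp ((smul_eq_zero.mp h3).resolve_left two_ne_zero)
  · simp only [map_smul, smul_apply]
    module

theorem sub_isBigO (h : HasQuadraticExpansion G Q) (h' : HasQuadraticExpansion G' Q')
    (hQ : ∀ x, Q x x = Q' x x) : (fun x => G x - G' x) =O[𝓝 0] fun x => ‖x‖ ^ 3 := by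
  refine (h.isBigO_cube.sub h'.isBigO_cube).congr_left fun x => ?_
  rw [hQ]
  abel

end HasQuadraticExpansion

theorem HasQuadraticPart.diag_unique {G : E → E} {Q Q' : E →L[ℝ] E →L[ℝ] E}
    (h : HasQuadraticPart G Q) (h' : HasQuadraticPart G Q') (x : E) : Q x x = Q' x x := by
  have h1 := eq_zero_of_homogeneous_isLittleO (q := fun x => Q' x x - Q x x) 2 (fun t y => ?_)
    ((h.isLittleO.sub h'.isLittleO).congr_left fun x => by abel) x
  · exact (sub_eq_zero.mp h1).symm
  · simp only [map_smul, smul_apply]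
    module

theorem bilin_eq_of_diag {Q Q' : E →L[ℝ] E →L[ℝ] E} (hs : ∀ x y, Q x y = Q y x)
    (hs' : ∀ x y, Q' x y = Q' y x) (h : ∀ x, Q x x = Q' x x) (x y : E) : Q x y = Q' x y := by
  have h1 := h (x + y)
  simp only [map_add, add_apply, h x, h y, hs y x, hs' y x] at h1
  have h2 : (2 : ℝ) • Q x y = (2 : ℝ) • Q' x y := by linear_combination (norm := module) h1
  exact smul_right_injective E (two_ne_zero' ℝ) h2

end QuadraticExpansion

/-! ### First and second differentials of germs, and their continuity. -/

section GermDerivatives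

variable {E : Type*} [NormedAddCommGroup E] [NormedSpace ℝ E]

theorem LocalDiffeo.germ_eq_iff {f g : LocalDiffeo E} :
    f.germ = g.germ ↔ f.toFun =ᶠ[𝓝 0] g.toFun :=
  Quotient.eq

theorem LocalDiffeo.germ_mul (f g : LocalDiffeo E) : f.germ * g.germ = (f.comp g).germ := rfl

theorem LocalDiffeo.exists_germ_eq_pow (f : LocalDiffeo E) (m : ℕ) :
    ∃ g : LocalDiffeo E, g.germ = f.germ ^ m ∧ g.toFun = f.toFun^[m] := by
  induction m with
  | zero => exact ⟨LocalDiffeo.id, rfl, rfl⟩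
  | succ m ih =>
    obtain ⟨g, hg, hg'⟩ := ih
    refine ⟨g.comp f, ?_, ?_⟩
    · rw [pow_succ, ← hg, germ_mul]
    · rw [Function.iterate_succ, ← hg']
      rfl

namespace DiffGerm

theorem exists_rep (F : DiffGerm E) : ∃ f : LocalDiffeo E, f.germ = F := Quotient.exists_rep F

/-- The differential of a germ at the origin. -/
noncomputable def differential (F : DiffGerm E) : E →L[ℝ] E :=
  Quotient.lift (fun f : LocalDiffeo E => fderiv ℝ f.toFun 0)
    (fun f g h => (show f.toFun =ᶠ[𝓝 0] g.toFun from h).fderiv_eq) F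

/-- The second differential of a germ at the origin. -/
noncomputable def secondDifferential (F : DiffGerm E) : E →L[ℝ] E →L[ℝ] E :=
  Quotient.lift (fun f : LocalDiffeo E => fderiv ℝ (fderiv ℝ f.toFun) 0)
    (fun f g h => (show f.toFun =ᶠ[𝓝 0] g.toFun from h).fderiv.fderiv_eq) F

theorem differential_germ (f : LocalDiffeo E) : f.germ.differential = fderiv ℝ f.toFun 0 := rfl

theorem secondDifferential_germ (f : LocalDiffeo E) :
    f.germ.secondDifferential = fderiv ℝ (fderiv ℝ f.toFun) 0 := rfl

theorem differential_apply (F : DiffGerm E) (x : E) :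
    F.differential x = derivAtZero 1 F ![x] := by
  obtain ⟨f, rfl⟩ := F.exists_rep
  change _ = iteratedFDeriv ℝ 1 f.toFun 0 ![x]
  rw [iteratedFDeriv_one_apply]
  rfl

theorem secondDifferential_apply (F : DiffGerm E) (x y : E) :
    F.secondDifferential x y = derivAtZero 2 F ![x, y] := by
  obtain ⟨f, rfl⟩ := F.exists_rep
  change _ = iteratedFDeriv ℝ 2 f.toFun 0 ![x, y]
  rw [iteratedFDeriv_two_apply]
  rfl

theorem _root_.LocalDiffeo.contDiffAt (f : LocalDiffeo E) : ContDiffAt ℝ ∞ f.toFun 0 :=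
  f.smooth_toFun.self_of_nhds

theorem _root_.LocalDiffeo.hasStrictFDerivAt (f : LocalDiffeo E) :
    HasStrictFDerivAt f.toFun (fderiv ℝ f.toFun 0) 0 :=
  f.contDiffAt.hasStrictFDerivAt (by simp)

theorem differential_mul (F G : DiffGerm E) :
    (F * G).differential = F.differential * G.differential := by
  obtain ⟨f, rfl⟩ := F.exists_rep
  obtain ⟨g, rfl⟩ := G.exists_rep
  rw [LocalDiffeo.germ_mul]
  have hf : HasFDerivAt f.toFun (fderiv ℝ f.toFun 0) (g.toFun 0) := by
    rw [g.map_zero]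
    exact f.hasStrictFDerivAt.hasFDerivAt
  exact (hf.comp (0 : E) g.hasStrictFDerivAt.hasFDerivAt).fderiv

theorem differential_one : (1 : DiffGerm E).differential = 1 :=
  (hasFDerivAt_id (𝕜 := ℝ) (0 : E)).fderiv

theorem differential_pow (F : DiffGerm E) (m : ℕ) :
    (F ^ m).differential = F.differential ^ m := by
  induction m with
  | zero => exact differential_one
  | succ m ih => rw [pow_succ, pow_succ, differential_mul, ih]

theorem continuous_derivAtZero {r i : ℕ} (h1 : 1 ≤ i) (hi : i ≤ r) :
    Continuous[locTopology E r, inferInstance] (derivAtZero (E := E) i) := by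
  let := locPseudoMetric E r
  refine LipschitzWith.continuous (K := 1) (LipschitzWith.of_dist_le_mul fun F G => ?_)
  rw [NNReal.coe_one, one_mul, dist_eq_norm]
  exact Finset.single_le_sum (f := fun i => ‖derivAtZero i F - derivAtZero i G‖)
    (fun _ _ => norm_nonneg _) (Finset.mem_Icc.mpr ⟨h1, hi⟩)

section Action

variable {Γ : Type*} [Group Γ]

theorem continuous_derivAtZero_action {r i : ℕ} (h1 : 1 ≤ i) (hi : i ≤ r) (γ : Γ) :
    Continuous[locActionTopology Γ E r, inferInstance]
      (fun P : Γ →* DiffGerm E => derivAtZero i (P γ)) := by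
  let _ := locTopology E r
  let _ := locActionTopology Γ E r
  have h2 : Continuous fun P : Γ →* DiffGerm E => P γ :=
    (continuous_apply γ).comp continuous_induced_dom
  exact (continuous_derivAtZero h1 hi).comp h2

variable [FiniteDimensional ℝ E]

theorem continuous_differential_action (γ : Γ) : Continuous[locActionTopology Γ E 2, inferInstance]
    (fun P : Γ →* DiffGerm E => (P γ).differential) := by
  let _ := locActionTopology Γ E 2
  refine continuous_clm_apply.mpr fun x => ?_
  simp only [differential_apply]
  exact (ContinuousMultilinearMap.apply ℝ (fun _ : Fin 1 => E) E ![x]).continuous.comp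
    (continuous_derivAtZero_action le_rfl (by norm_num) γ)

theorem continuous_secondDifferential_action (γ : Γ) :
    Continuous[locActionTopology Γ E 2, inferInstance]
      (fun P : Γ →* DiffGerm E => (P γ).secondDifferential) := by
  let _ := locActionTopology Γ E 2
  refine continuous_clm_apply.mpr fun x => continuous_clm_apply.mpr fun y => ?_
  simp only [secondDifferential_apply]
  exact (ContinuousMultilinearMap.apply ℝ (fun _ : Fin 2 => E) E ![x, y]).continuous.comp
    (continuous_derivAtZero_action (by norm_num) le_rfl γ)

end Action

end DiffGerm

theorem HasQuadraticPart.hasFDerivAt {G : E → E} {Q : E →L[ℝ] E →L[ℝ] E}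
    (h : HasQuadraticPart G Q) : HasFDerivAt G (ContinuousLinearMap.id ℝ E) 0 := by
  refine HasFDerivAt.of_isLittleO ?_
  simpa [h.map_zero] using h.isBigO_sub.trans_isLittleO
    (Asymptotics.isLittleO_norm_pow_id one_lt_two)

theorem LocalDiffeo.hasQuadraticExpansion {g : LocalDiffeo E} (h : g.germ.differential = 1) :
    HasQuadraticExpansion g.toFun ((2 : ℝ)⁻¹ • g.germ.secondDifferential) :=
  HasQuadraticExpansion.of_contDiffAt (g.contDiffAt.of_le (by norm_cast)) g.map_zero h
    fun x y => by
      rw [smul_apply, smul_apply, smul_inv_smul₀ two_ne_zero]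
      rfl

theorem LocalDiffeo.secondDifferential_symm (g : LocalDiffeo E) (x y : E) :
    ((2 : ℝ)⁻¹ • g.germ.secondDifferential) x y = ((2 : ℝ)⁻¹ • g.germ.secondDifferential) y x := by
  have h := symm_secondDeriv (g.contDiffAt.of_le (by norm_cast)) x y
  simp only [smul_apply, DiffGerm.secondDifferential_germ, h]

end GermDerivatives

/-! ### The 2-jets of the standard local action. -/

section StandardLocalAction

open Asymptotics

variable {n k : ℕ}

theorem bsGroup_conj_rel (i : Fin n) :
    (PresentedGroup.of .a * PresentedGroup.of (.b i) : BSGroup n k) =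
      PresentedGroup.of (.b i) ^ k * PresentedGroup.of .a := by
  have h := PresentedGroup.one_of_mem (rels := bsRels n k)
    (x := FreeGroup.of .a * FreeGroup.of (.b i) * (FreeGroup.of .a)⁻¹ *
      (FreeGroup.of (.b i) ^ k)⁻¹) (Or.inl ⟨i, rfl⟩)
  simp only [map_mul, map_inv, map_pow] at h
  exact mul_inv_eq_iff_eq_mul.mp (mul_inv_eq_one.mp h)

theorem bsGroup_comm_rel (i j : Fin n) :
    (PresentedGroup.of (.b i) * PresentedGroup.of (.b j) : BSGroup n k) =
      PresentedGroup.of (.b j) * PresentedGroup.of (.b i) := by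
  have h := PresentedGroup.one_of_mem (rels := bsRels n k)
    (x := FreeGroup.of (.b i) * FreeGroup.of (.b j) *
      (FreeGroup.of (.b j) * FreeGroup.of (.b i))⁻¹) (Or.inr ⟨i, j, rfl⟩)
  simp only [map_mul, map_inv] at h
  exact mul_inv_eq_one.mp h

/-- Here `s` and `v` are prescribed, whereas `localMap_formula` only asserts their existence; this
identifies the generators. -/
theorem localMap_of_affine (hk : 2 ≤ k) (B : Matrix (Fin n) (Fin n) ℝ) {γ : BSGroup n k} {s : ℝ}
    {v : Eucl n} (h : ∀ x : Eucl n, standardAction hk B γ (x : OnePoint (Eucl n)) =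
        ((s • x + v : Eucl n) : OnePoint (Eucl n))) (y : Eucl n) : localMap hk B γ y =
      (s ^ 2 + 2 * s * inner ℝ y v + ‖y‖ ^ 2 * ‖v‖ ^ 2)⁻¹ • (s • y + ‖y‖ ^ 2 • v) := by
  by_cases hy : y = 0
  · subst hy
    rw [localMap_zero]
    simp
  · have h' : ‖y‖ ≠ 0 := norm_ne_zero_iff.mpr hy
    rw [localMap, inversionChartInv, if_neg hy, h, inversionChart_coe]
    have h1 : s • (‖y‖ ^ 2)⁻¹ • y + v = (‖y‖ ^ 2)⁻¹ • (s • y + ‖y‖ ^ 2 • v) := by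
      rw [smul_add, smul_smul (‖y‖ ^ 2)⁻¹ (‖y‖ ^ 2), inv_mul_cancel₀ (by positivity), one_smul,
        smul_comm]
    have h2 : ‖s • y + ‖y‖ ^ 2 • v‖ ^ 2 =
        ‖y‖ ^ 2 * (s ^ 2 + 2 * s * inner ℝ y v + ‖y‖ ^ 2 * ‖v‖ ^ 2) := by
      rw [norm_add_sq_real, norm_smul, norm_smul, real_inner_smul_left, real_inner_smul_right,
        mul_pow, mul_pow, Real.norm_eq_abs, sq_abs, norm_pow, norm_norm]
      ring
    rw [h1, norm_smul, mul_pow, h2, smul_smul, norm_inv, norm_pow, norm_norm]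
    congr 1
    rw [mul_inv, mul_inv, ← inv_pow, ← inv_pow]
    field_simp

theorem localMap_a (hk : 2 ≤ k) (B : Matrix (Fin n) (Fin n) ℝ) (y : Eucl n) :
    localMap hk B (PresentedGroup.of .a) y = (k : ℝ)⁻¹ • y := by
  have hk0 : (k : ℝ) ≠ 0 := by positivity
  rw [localMap_of_affine hk B (s := k) (v := 0) fun x => by
    rw [standardAction, PresentedGroup.toGroup.of, add_zero]
    rfl]
  simp only [inner_zero_right, norm_zero, smul_zero, add_zero, smul_smul]
  congr 1
  field_simp
  ring

theorem localMap_b (hk : 2 ≤ k) (B : Matrix (Fin n) (Fin n) ℝ) (i : Fin n) (y : Eucl n) :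
    localMap hk B (PresentedGroup.of (.b i)) y =
      (1 + 2 * inner ℝ y (column B i) + ‖y‖ ^ 2 * ‖column B i‖ ^ 2)⁻¹ •
        (y + ‖y‖ ^ 2 • column B i) := by
  rw [localMap_of_affine hk B (s := 1) (v := column B i) fun x => by
    rw [standardAction, PresentedGroup.toGroup.of, one_smul]
    rfl]
  simp

theorem hasQuadraticPart_localMap_b (hk : 2 ≤ k) (B : Matrix (Fin n) (Fin n) ℝ) (i : Fin n) :
    HasQuadraticPart (localMap hk B (PresentedGroup.of (.b i)))
      (inversionTensor (Eucl n) (column B i)) := by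
  refine ⟨localMap_zero _ _ _, ?_⟩
  obtain ⟨v, hv⟩ : ∃ v, v = column B i := ⟨_, rfl⟩
  rw [← hv]
  have hc : Continuous fun y : Eucl n => 1 + 2 * inner ℝ y v + ‖y‖ ^ 2 * ‖v‖ ^ 2 := by fun_prop
  have hne : ∀ᶠ y in 𝓝 (0 : Eucl n), 1 + 2 * inner ℝ y v + ‖y‖ ^ 2 * ‖v‖ ^ 2 ≠ 0 :=
    hc.continuousAt.eventually_ne (by simp)
  have h1 : (fun y : Eucl n => (1 + 2 * inner ℝ y v + ‖y‖ ^ 2 * ‖v‖ ^ 2)⁻¹) =O[𝓝 0]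
      fun _ => (1 : ℝ) := (hc.continuousAt.inv₀ (by simp)).norm.isBoundedUnder_le.isBigO_one ℝ
  have hi : (fun y : Eucl n => inner ℝ y v) =O[𝓝 0] fun y => ‖y‖ :=
    IsBigO.of_bound ‖v‖ <| Eventually.of_forall fun y => by
      rw [norm_norm, mul_comm]
      exact norm_inner_le_norm y v
  have hq := isBigO_diag (inversionTensor (Eucl n) v)
  have hn : (fun y : Eucl n => ‖y‖ ^ 2 * ‖v‖ ^ 2) =O[𝓝 0] fun y => ‖y‖ ^ 2 := by
    simpa [mul_comm] using (isBigO_refl (fun y : Eucl n => ‖y‖ ^ 2) (𝓝 0)).const_mul_left (‖v‖ ^ 2)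
  have hδ : (fun y : Eucl n => 2 * inner ℝ y v + ‖y‖ ^ 2 * ‖v‖ ^ 2) =O[𝓝 0] fun y => ‖y‖ :=
    (hi.const_mul_left 2).add (hn.trans HasQuadraticPart.norm_sq_isBigO)
  have h2 : (fun y : Eucl n => -((‖y‖ ^ 2 * ‖v‖ ^ 2) • y) - (2 * inner ℝ y v + ‖y‖ ^ 2 * ‖v‖ ^ 2) •
      inversionTensor (Eucl n) v y y) =O[𝓝 0] fun y => ‖y‖ ^ 3 := by
    have e1 := (hn.smul (isBigO_id_norm (E := Eucl n))).neg_left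
    have e2 := hδ.smul hq
    exact (e1.congr_right fun y => by simp only [smul_eq_mul]; ring).sub
      (e2.congr_right fun y => by simp only [smul_eq_mul]; ring)
  have h3 := (h1.smul h2).congr_right (g₂ := fun y => ‖y‖ ^ 3) fun y => by simp
  refine IsBigO.trans_isLittleO (h3.congr' ?_ EventuallyEq.rfl)
    (isLittleO_norm_pow_norm_pow (E' := Eucl n) (by norm_num : 2 < 3))
  filter_upwards [hne] with y hy
  rw [localMap_b, ← hv]
  -- Over the common denominator the terms of order at most two cancel, leaving the inverse
  -- denominator times the O(‖y‖³) expression of `h2`.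
  have h4 : y + inversionTensor (Eucl n) v y y =
      (1 + 2 * inner ℝ y v + ‖y‖ ^ 2 * ‖v‖ ^ 2)⁻¹ • (1 + 2 * inner ℝ y v + ‖y‖ ^ 2 * ‖v‖ ^ 2) •
        (y + inversionTensor (Eucl n) v y y) := (inv_smul_smul₀ hy _).symm
  rw [sub_sub, h4, ← smul_sub]
  congr 1
  simp only [inversionTensor_apply, real_inner_self_eq_norm_sq]
  module

theorem standardLocalAction_apply (hk : 2 ≤ k) (B : Matrix (Fin n) (Fin n) ℝ) (γ : BSGroup n k) :
    standardLocalAction hk B γ = (localMapDiffeo hk B γ).germ := rfl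

theorem differential_standard_a (hk : 2 ≤ k) (B : Matrix (Fin n) (Fin n) ℝ) :
    (standardLocalAction hk B (PresentedGroup.of .a)).differential = (k : ℝ)⁻¹ • 1 := by
  have h : (localMapDiffeo hk B (PresentedGroup.of .a)).toFun = fun y => (k : ℝ)⁻¹ • y :=
    funext fun y => localMap_a hk B y
  rw [standardLocalAction_apply, DiffGerm.differential_germ, h]
  exact ((hasFDerivAt_id (𝕜 := ℝ) (0 : Eucl n)).const_smul (k : ℝ)⁻¹).fderiv

theorem differential_standard_b (hk : 2 ≤ k) (B : Matrix (Fin n) (Fin n) ℝ) (i : Fin n) :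
    (standardLocalAction hk B (PresentedGroup.of (.b i))).differential = 1 :=
  (hasQuadraticPart_localMap_b hk B i).hasFDerivAt.fderiv

theorem secondDifferential_standard_b (hk : 2 ≤ k) (B : Matrix (Fin n) (Fin n) ℝ) (i : Fin n) :
    (2 : ℝ)⁻¹ • (standardLocalAction hk B (PresentedGroup.of (.b i))).secondDifferential =
      inversionTensor (Eucl n) (column B i) := by
  have h := LocalDiffeo.hasQuadraticExpansion (differential_standard_b hk B i)
  have h1 := h.hasQuadraticPart.diag_unique (hasQuadraticPart_localMap_b hk B i)
  ext x y : 2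
  exact bilin_eq_of_diag (LocalDiffeo.secondDifferential_symm _)
    (fun x y => inversionTensor_isSymm _ x y) h1 x y

/-- The linear map of matrix `B` sends the `i`-th vector of the standard basis to the `i`-th column
of `B`. -/
theorem toEuclideanCLM_single (B : Matrix (Fin n) (Fin n) ℝ) (i : Fin n) :
    Matrix.toEuclideanCLM (𝕜 := ℝ) B (EuclideanSpace.single i 1) = column B i := by
  ext j
  simp [column, Matrix.ofLp_toEuclideanCLM]

end StandardLocalAction

/-! ### From rigid 2-jets to smooth conjugacy. -/

section LocalRigidity

set_option maxSynthPendingDepth 3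

variable {n k : ℕ}

/-- The family of bilinear maps taking the value `R i` at the `i`-th column of `B`. -/
noncomputable def quadraticFamily (B : Matrix.GeneralLinearGroup (Fin n) ℝ)
    (R : Fin n → Eucl n →L[ℝ] Eucl n →L[ℝ] Eucl n) : TriMap (Eucl n) :=
  ∑ i, ContinuousLinearMap.smulRight ((EuclideanSpace.proj (𝕜 := ℝ) i).comp
    (Matrix.toEuclideanCLM (𝕜 := ℝ) (↑B⁻¹ : Matrix (Fin n) (Fin n) ℝ))) (R i)

theorem quadraticFamily_apply (B : Matrix.GeneralLinearGroup (Fin n) ℝ)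
    (R : Fin n → Eucl n →L[ℝ] Eucl n →L[ℝ] Eucl n) (v : Eucl n) :
    quadraticFamily B R v = ∑ i,
      (Matrix.toEuclideanCLM (𝕜 := ℝ) (↑B⁻¹ : Matrix (Fin n) (Fin n) ℝ) v) i • R i := by
  simp [quadraticFamily]

theorem quadraticFamily_column (B : Matrix.GeneralLinearGroup (Fin n) ℝ)
    (R : Fin n → Eucl n →L[ℝ] Eucl n →L[ℝ] Eucl n) (i : Fin n) :
    quadraticFamily B R (column (B : Matrix (Fin n) (Fin n) ℝ) i) = R i := by
  have h : Matrix.toEuclideanCLM (𝕜 := ℝ) (↑B⁻¹ : Matrix (Fin n) (Fin n) ℝ)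
      (column (B : Matrix (Fin n) (Fin n) ℝ) i) = EuclideanSpace.single i 1 := by
    rw [← toEuclideanCLM_single, ← mul_apply_eq_comp, ← map_mul, Units.inv_mul, map_one,
      one_apply_eq_self]
  rw [quadraticFamily_apply, h]
  simp

theorem sum_smul_column (B : Matrix.GeneralLinearGroup (Fin n) ℝ) (v : Eucl n) :
    ∑ i, (Matrix.toEuclideanCLM (𝕜 := ℝ) (↑B⁻¹ : Matrix (Fin n) (Fin n) ℝ) v) i •
      column (B : Matrix (Fin n) (Fin n) ℝ) i = v := by
  have h : v = Matrix.toEuclideanCLM (𝕜 := ℝ) (B : Matrix (Fin n) (Fin n) ℝ)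
      (Matrix.toEuclideanCLM (𝕜 := ℝ) (↑B⁻¹ : Matrix (Fin n) (Fin n) ℝ) v) := by
    rw [← mul_apply_eq_comp, ← map_mul, Units.mul_inv, map_one, one_apply_eq_self]
  conv_rhs => rw [h]
  generalize Matrix.toEuclideanCLM (𝕜 := ℝ) (↑B⁻¹ : Matrix (Fin n) (Fin n) ℝ) v = w
  ext j
  simp [column, Matrix.ofLp_toEuclideanCLM, Matrix.mulVec, dotProduct, mul_comm]

theorem quadraticFamily_inversionTensor (B : Matrix.GeneralLinearGroup (Fin n) ℝ) :
    quadraticFamily B (fun i => inversionTensor (Eucl n)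
      (column (B : Matrix (Fin n) (Fin n) ℝ) i)) = inversionTensor (Eucl n) := by
  ext v : 1
  rw [quadraticFamily_apply]
  conv_rhs => rw [← sum_smul_column B v]
  simp only [map_sum, map_smul]

/-- A linear automorphism as a local diffeomorphism. -/
def ContinuousLinearEquiv.toLocalDiffeo {E : Type*} [NormedAddCommGroup E] [NormedSpace ℝ E]
    (L : E ≃L[ℝ] E) : LocalDiffeo E where
  toFun := L
  invFun := L.symm
  map_zero := L.map_zero
  smooth_toFun := Eventually.of_forall fun _ => L.contDiff.contDiffAt
  smooth_invFun := Eventually.of_forall fun _ => L.symm.contDiff.contDiffAt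
  left_inv := Eventually.of_forall L.symm_apply_apply
  right_inv := Eventually.of_forall L.apply_symm_apply

theorem exists_generalLinearGroup_column (B : Matrix.GeneralLinearGroup (Fin n) ℝ)
    (M : Eucl n ≃L[ℝ] Eucl n) : ∃ B' : Matrix.GeneralLinearGroup (Fin n) ℝ, ∀ i,
      column (B' : Matrix (Fin n) (Fin n) ℝ) i = M (column (B : Matrix (Fin n) (Fin n) ℝ) i) := by
  let e : (Eucl n →L[ℝ] Eucl n) ≃⋆ₐ[ℝ] Matrix (Fin n) (Fin n) ℝ :=
    (Matrix.toEuclideanCLM (n := Fin n) (𝕜 := ℝ)).symm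
  refine ⟨Units.map (e : (Eucl n →L[ℝ] Eucl n) →* Matrix (Fin n) (Fin n) ℝ) M.toUnit * B, fun i => ?_⟩
  rw [← toEuclideanCLM_single, ← toEuclideanCLM_single, Units.val_mul, map_mul, Units.coe_map]
  simp [e]
  rfl

/-- The germ of a conjugate of a standard generator satisfies the functional equation used for
uniqueness. -/
theorem eventually_functional_equation {E : Type*} [NormedAddCommGroup E] [NormedSpace ℝ E]
    (hk : 2 ≤ k) {f g : LocalDiffeo E} (hf : ∀ᶠ x in 𝓝 0, f.toFun x = (k : ℝ)⁻¹ • x)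
    (h : f.germ * g.germ = g.germ ^ k * f.germ) :
    ∀ᶠ x in 𝓝 0, g.toFun x = (k : ℝ) • g.toFun^[k] ((k : ℝ)⁻¹ • x) := by
  have hk0 : (k : ℝ) ≠ 0 := by positivity
  obtain ⟨p, hp, hp'⟩ := g.exists_germ_eq_pow k
  rw [← hp, LocalDiffeo.germ_mul, LocalDiffeo.germ_mul, LocalDiffeo.germ_eq_iff] at h
  filter_upwards [h, hf, g.tendsto.eventually hf] with x h1 h2 h3
  change f.toFun (g.toFun x) = p.toFun (f.toFun x) at h1
  rw [h2, h3, hp'] at h1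
  rw [← h1, smul_inv_smul₀ hk0]

/-- The linearizer of a is tangent to the identity, so it leaves the quadratic parts of the bᵢ
unchanged; composing with `L.symm`, which commutes with homotheties, normalizes them. The conjugated
action and the standard one then agree on a and have equal 2-jets on each bᵢ, and the functional
equation gives equality. -/
theorem exists_smoothlyConjugate (hk : 2 ≤ k) (B : Matrix.GeneralLinearGroup (Fin n) ℝ)
    (P : BSGroup n k →* DiffGerm (Eucl n))
    (hA : (P (PresentedGroup.of .a)).differential = (k : ℝ)⁻¹ • 1)
    (hC : ∀ i, (P (PresentedGroup.of (.b i))).differential = 1) (L M : Eucl n ≃L[ℝ] Eucl n)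
    (hQ : ∀ i x y, ((2 : ℝ)⁻¹ • (P (PresentedGroup.of (.b i))).secondDifferential) x y =
      L (inversionTensor (Eucl n) (M (column (B : Matrix (Fin n) (Fin n) ℝ) i))
        (L.symm x) (L.symm y))) :
    ∃ B' : Matrix.GeneralLinearGroup (Fin n) ℝ,
      SmoothlyConjugate P (standardLocalAction hk (B' : Matrix (Fin n) (Fin n) ℝ)) := by
  have hk' : (1 : ℝ) < k := by exact_mod_cast hk
  obtain ⟨f, hf⟩ := (P (PresentedGroup.of .a)).exists_rep
  have hcontr : IsHomotheticContraction (k : ℝ)⁻¹ f.toFun := by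
    refine ⟨by positivity, inv_lt_one_of_one_lt₀ hk', f.map_zero, f.contDiffAt, ?_⟩
    have h := f.hasStrictFDerivAt.hasFDerivAt
    rw [← DiffGerm.differential_germ, hf, hA] at h
    exact h
  obtain ⟨H₀, hH₀, hlin⟩ := hcontr.exists_linearization f.smooth_toFun
  obtain ⟨B', hB'⟩ := exists_generalLinearGroup_column B M
  refine ⟨B', ?_⟩
  obtain ⟨H, hH⟩ : ∃ H, H = L.symm.toLocalDiffeo.comp H₀ := ⟨_, rfl⟩
  have hHx : ∀ x, H.toFun x = L.symm (H₀.toFun x) := fun x => by rw [hH]; rfl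
  have hHd : HasStrictFDerivAt H.toFun (L.symm : Eucl n →L[ℝ] Eucl n) 0 := by
    have h1 := H.hasStrictFDerivAt
    have h2 : HasFDerivAt H.toFun (L.symm : Eucl n →L[ℝ] Eucl n) 0 := by
      have h3 := (L.symm.hasFDerivAt (x := H₀.toFun 0)).comp (0 : Eucl n) hH₀
      rw [hH]
      exact h3
    rwa [h2.fderiv] at h1
  obtain ⟨S, hS⟩ : ∃ S, S = standardLocalAction hk (B' : Matrix (Fin n) (Fin n) ℝ) := ⟨_, rfl⟩
  rw [← hS]
  let α : BSGroup n k →* DiffGerm (Eucl n) := (MulAut.conj H.germ).toMonoidHom.comp P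
  have hα : ∀ γ, α γ = H.germ * P γ * H.germ⁻¹ := fun γ => rfl
  have hαH : ∀ γ, α γ * H.germ = H.germ * P γ := fun γ => by
    rw [hα, inv_mul_cancel_right]
  suffices hSα : S = α from ⟨H.germ, fun γ => by rw [hSα, hαH]⟩
  have hSa : S (PresentedGroup.of .a) = α (PresentedGroup.of .a) := by
    rw [hα, eq_mul_inv_iff_mul_eq, ← hf, hS, standardLocalAction_apply, LocalDiffeo.germ_mul,
      LocalDiffeo.germ_mul, LocalDiffeo.germ_eq_iff]
    filter_upwards [hlin] with x hx
    change localMap hk _ _ (H.toFun x) = H.toFun (f.toFun x)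
    rw [localMap_a, hHx, hHx, hx, map_smul]
  refine PresentedGroup.ext fun γ => ?_
  cases γ with
  | a => exact hSa
  | b i =>
    obtain ⟨g, hg⟩ := (P (PresentedGroup.of (.b i))).exists_rep
    obtain ⟨g', hg'⟩ := (α (PresentedGroup.of (.b i))).exists_rep
    let a := localMapDiffeo hk (B' : Matrix (Fin n) (Fin n) ℝ) (PresentedGroup.of .a)
    let s := localMapDiffeo hk (B' : Matrix (Fin n) (Fin n) ℝ) (PresentedGroup.of (.b i))
    have ha : a.germ = S (PresentedGroup.of .a) := by rw [hS]; rfl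
    have hs : s.germ = S (PresentedGroup.of (.b i)) := by rw [hS]; rfl
    have ha' : ∀ᶠ x in 𝓝 0, a.toFun x = (k : ℝ)⁻¹ • x :=
      Eventually.of_forall fun x => localMap_a hk _ x
    have hsemi : ∀ᶠ x in 𝓝 0, H.toFun (g.toFun x) = g'.toFun (H.toFun x) := by
      have h := hαH (PresentedGroup.of (.b i))
      rw [← hg, ← hg', LocalDiffeo.germ_mul, LocalDiffeo.germ_mul, LocalDiffeo.germ_eq_iff] at h
      exact h.symm
    have hgd : g.germ.differential = 1 := by rw [hg, hC]
    have hg'd : g'.germ.differential = 1 := by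
      rw [hg', hα, DiffGerm.differential_mul, DiffGerm.differential_mul, hC, mul_one,
        ← DiffGerm.differential_mul, mul_inv_cancel, DiffGerm.differential_one]
    have hsd : s.germ.differential = 1 := differential_standard_b hk _ i
    have hge := LocalDiffeo.hasQuadraticExpansion hgd
    have hg'e := LocalDiffeo.hasQuadraticExpansion hg'd
    have hse := LocalDiffeo.hasQuadraticExpansion hsd
    have hsq : (2 : ℝ)⁻¹ • s.germ.secondDifferential =
        inversionTensor (Eucl n) (M (column (B : Matrix (Fin n) (Fin n) ℝ) i)) := by
      rw [← hB']
      exact secondDifferential_standard_b hk _ i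
    -- `semiconj` is evaluated at `L x`, so that `L` and its inverse cancel.
    have hdiag : ∀ x, ((2 : ℝ)⁻¹ • s.germ.secondDifferential) x x =
        ((2 : ℝ)⁻¹ • g'.germ.secondDifferential) x x := fun x => by
      have h := hge.hasQuadraticPart.semiconj hg'e.hasQuadraticPart H.map_zero hHd hsemi (L x)
      rw [hg, hQ] at h
      rw [hsq]
      simpa using h
    rw [← hs, ← hg', LocalDiffeo.germ_eq_iff]
    have hsd' := s.hasStrictFDerivAt
    have hg'd' := g'.hasStrictFDerivAt
    rw [← DiffGerm.differential_germ, hsd] at hsd'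
    rw [← DiffGerm.differential_germ, hg'd] at hg'd'
    refine eventuallyEq_of_functional_equation hk s.map_zero g'.map_zero hsd' hg'd'
      (hse.sub_isBigO hg'e hdiag) ?_ ?_
    · refine eventually_functional_equation hk ha' ?_
      rw [ha, hs, ← map_mul, ← map_pow, ← map_mul, bsGroup_conj_rel]
    · refine eventually_functional_equation hk ha' ?_
      rw [ha, hg', hSa, ← map_mul, ← map_pow, ← map_mul, bsGroup_conj_rel]

theorem theorem2p1 (n k : ℕ) (hn : 1 ≤ n) (hk : 2 ≤ k)
    (B : Matrix.GeneralLinearGroup (Fin n) ℝ) :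
    ∃ U ∈ @nhds (BSGroup n k →* DiffGerm (Eucl n)) (locActionTopology (BSGroup n k) (Eucl n) 2)
        (standardLocalAction hk (B : Matrix (Fin n) (Fin n) ℝ)),
      ∀ P ∈ U, ∃ B' : Matrix.GeneralLinearGroup (Fin n) ℝ,
        SmoothlyConjugate P (standardLocalAction hk (B' : Matrix (Fin n) (Fin n) ℝ)) := by
  let _ := locActionTopology (BSGroup n k) (Eucl n) 2
  -- This makes `Eucl n` nontrivial, as `eventually_exists_equiv` requires (its proof divides by the
  -- dimension).
  have : Nonempty (Fin n) := ⟨⟨0, hn⟩⟩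
  obtain ⟨P₀, hP₀⟩ : ∃ P₀, P₀ = standardLocalAction hk (B : Matrix (Fin n) (Fin n) ℝ) := ⟨_, rfl⟩
  rw [← hP₀]
  let Q : (BSGroup n k →* DiffGerm (Eucl n)) → TriMap (Eucl n) := fun P =>
    quadraticFamily B fun i => (2 : ℝ)⁻¹ • (P (PresentedGroup.of (.b i))).secondDifferential
  have hQ0 : Q P₀ = inversionTensor (Eucl n) := by
    simp only [Q, hP₀, secondDifferential_standard_b, quadraticFamily_inversionTensor]
  have hQc : Continuous Q := by
    have h1 : ∀ i : Fin n, Continuous fun P : BSGroup n k →* DiffGerm (Eucl n) =>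
        (P (PresentedGroup.of (.b i))).secondDifferential := fun i =>
      DiffGerm.continuous_secondDifferential_action _
    refine continuous_clm_apply.mpr fun v => ?_
    simp only [Q, quadraticFamily_apply]
    fun_prop
  have hDa : Continuous fun P : BSGroup n k →* DiffGerm (Eucl n) =>
      (P (PresentedGroup.of .a)).differential := DiffGerm.continuous_differential_action _
  have hDb : ∀ i : Fin n, Continuous fun P : BSGroup n k →* DiffGerm (Eucl n) =>
      (P (PresentedGroup.of (.b i))).differential := fun i =>
    DiffGerm.continuous_differential_action _
  have ha0 : (P₀ (PresentedGroup.of .a)).differential = (k : ℝ)⁻¹ • 1 := by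
    rw [hP₀, differential_standard_a]
  have hb0 : ∀ i, (P₀ (PresentedGroup.of (.b i))).differential = 1 := fun i => by
    rw [hP₀, differential_standard_b]
  have hk0 : (0 : ℝ) < (k : ℝ)⁻¹ := by positivity
  have e1 : ∀ᶠ P in 𝓝 P₀, ∀ i : Fin n, (P (PresentedGroup.of .a)).differential *
      (P (PresentedGroup.of (.b i))).differential = (P (PresentedGroup.of (.b i))).differential ^ k *
      (P (PresentedGroup.of .a)).differential →
      (P (PresentedGroup.of (.b i))).differential = 1 := by
    refine eventually_all.mpr fun i => ?_
    have h := (hDa.prodMk (hDb i)).tendsto P₀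
    rw [ha0, hb0 i] at h
    exact h.eventually (eventually_eq_one_of_mul_eq_pow_mul hk hk0)
  have e2 := by
    have h := (hDa.prodMk hQc).tendsto P₀
    rw [ha0, hQ0] at h
    exact h.eventually (eventually_eq_smul_one_of_equivariant hk)
  have e3 := by
    have h := hQc.tendsto P₀
    rw [hQ0] at h
    exact h.eventually (eventually_exists_equiv (E := Eucl n))
  refine ⟨_, (e1.and (e2.and e3)), fun P hP => ?_⟩
  obtain ⟨h1, h2, h3⟩ := hP
  -- This comes first: only for germs tangent to the identity is the quadratic part of the k-th
  -- power `k` times the quadratic part, which is used for `hA`.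
  have hC : ∀ i, (P (PresentedGroup.of (.b i))).differential = 1 := fun i => by
    refine h1 i ?_
    rw [← DiffGerm.differential_pow, ← DiffGerm.differential_mul, ← DiffGerm.differential_mul,
      ← map_pow, ← map_mul, ← map_mul, bsGroup_conj_rel]
  choose g hg using fun i => (P (PresentedGroup.of (.b i))).exists_rep
  have hexp : ∀ i, HasQuadraticExpansion (g i).toFun
      ((2 : ℝ)⁻¹ • (P (PresentedGroup.of (.b i))).secondDifferential) := fun i => by
    have := LocalDiffeo.hasQuadraticExpansion (g := g i) (by rw [hg, hC])
    rwa [hg] at this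
  have hsymm : ∀ i x y, ((2 : ℝ)⁻¹ • (P (PresentedGroup.of (.b i))).secondDifferential) x y =
      ((2 : ℝ)⁻¹ • (P (PresentedGroup.of (.b i))).secondDifferential) y x := fun i x y => by
    rw [← hg i]
    exact LocalDiffeo.secondDifferential_symm _ x y
  have hQv : ∀ v x y, Q P v x y = ∑ i,
      (Matrix.toEuclideanCLM (𝕜 := ℝ) (↑B⁻¹ : Matrix (Fin n) (Fin n) ℝ) v) i •
      ((2 : ℝ)⁻¹ • (P (PresentedGroup.of (.b i))).secondDifferential) x y := fun v x y => by
    simp only [Q, quadraticFamily_apply, sum_apply, smul_apply]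
  -- The relation between a and bᵢ at second order gives the equivariance for each generator, and
  -- linearity in `v` extends it to the whole family.
  have hA : (P (PresentedGroup.of .a)).differential = (k : ℝ)⁻¹ • 1 := by
    refine h2 fun v x => ?_
    obtain ⟨f, hf⟩ := (P (PresentedGroup.of .a)).exists_rep
    simp only [hQv, map_sum, Finset.smul_sum]
    refine Finset.sum_congr rfl fun i _ => ?_
    obtain ⟨p, hp, hp'⟩ := (g i).exists_germ_eq_pow k
    have h4 := (hexp i).hasQuadraticPart.iterate k
    rw [← hp'] at h4
    have h5 : f.germ * (g i).germ = p.germ * f.germ := by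
      rw [hp, hf, hg, ← map_mul, ← map_pow, ← map_mul, bsGroup_conj_rel]
    rw [LocalDiffeo.germ_mul, LocalDiffeo.germ_mul, LocalDiffeo.germ_eq_iff] at h5
    have h6 := (hexp i).hasQuadraticPart.semiconj h4 f.map_zero f.hasStrictFDerivAt h5 x
    rw [← hf, DiffGerm.differential_germ, map_smul, h6]
    simp only [smul_apply]
    module
  obtain ⟨L, M, hLM⟩ := h3
    (fun v x y => by
      rw [hQv, hQv]
      exact Finset.sum_congr rfl fun i _ => by rw [hsymm])
    (fun v w x => by
      -- Commutation is bilinear in `v` and `w`, so it reduces to pairs of generators, where it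
      -- follows from bᵢbⱼ = bⱼbᵢ.
      simp only [hQv, map_sum, map_smul, Finset.smul_sum]
      rw [Finset.sum_comm]
      refine Finset.sum_congr rfl fun j _ => Finset.sum_congr rfl fun i _ => ?_
      have h4 : (g i).germ * (g j).germ = (g j).germ * (g i).germ := by
        rw [hg, hg, ← map_mul, ← map_mul, bsGroup_comm_rel]
      rw [LocalDiffeo.germ_mul, LocalDiffeo.germ_mul, LocalDiffeo.germ_eq_iff] at h4
      rw [(hexp i).commute (hexp j) (hsymm i) (hsymm j) h4, smul_comm])
  refine exists_smoothlyConjugate hk B P hA hC L M fun i x y => ?_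
  rw [← hLM, quadraticFamily_column]

end LocalRigidity
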